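/- Let $D \subset \mathbb{R}^n$ be an open, convex, bounded set; no smoothness of its boundary $\partial D$ is assumed. A hyperplane $L(\xi,p)=\{x\in\mathbb{R}^n : \langle x,\xi\rangle = p\}$, with $\xi \in S^{n-1}$ and $p\in\mathbb{R}$, is called a supporting plane to $D$ if it meets $\overline{D}$ and $D$ is contained in one of the two closed half-spaces bounded by $L(\xi,p)$. For a compactly supported distribution $f$ on $\mathbb{R}^n$, the Radon transform $\mathcal{R}f$ is the distribution on $S^{n-1}\times\mathbb{R}$ given by $$\langle \mathcal{R}f,\varphi\rangle = \langle f,\mathcal{R}^*\varphi\rangle,\qquad (\mathcal{R}^*\varphi)(x)=\int_{S^{n-1}}\varphi(\xi,\langle x,\xi\rangle)\,d\xi,\qquad \varphi\in C_c^\infty(S^{n-1}\times\mathbb{R}),$$ where $d\xi$ is surface measure on $S^{n-1}$ and $f$ acts on the smooth function $\mathcal{R}^*\varphi$ as a compactly supported distribution. Assume that there exists a distribution $f\neq 0$ on $\mathbb{R}^n$ (of arbitrary finite order, real- or complex-valued), supported in $\overline{D}$, such that the support of $\mathcal{R}f$ is contained in the set of $(\xi,p)$ for which $L(\xi,p)$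 is a supporting plane to $D$. Then $\partial D$ is an ellipsoid, that is, the image of the unit sphere of $\mathbb{R}^n$ under an invertible affine map of $\mathbb{R}^n$. -/

import Mathlib

open TopologicalSpace MeasureTheory Distribution
open scoped Distributions Topology ContDiff

namespace RadonSupport

/-- `ℝⁿ` with its Euclidean structure. -/
abbrev Euc (n : ℕ) : Type := EuclideanSpace ℝ (Fin n)

/-- The unit sphere `S^{n-1}` in `ℝⁿ`. -/
abbrev Sph (n : ℕ) : Type := Metric.sphere (0 : Euc n) 1

/-- The space `C_c^∞(S^{n-1} × ℝ)` of real test functions on the closed submanifold `S^{n-1} × ℝ`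
of `ℝⁿ × ℝ`: the functions that extend to a smooth compactly supported function on `ℝⁿ × ℝ`. -/
def CylTest (n : ℕ) : Submodule ℝ (Sph n × ℝ → ℝ) where
  carrier := {φ | ∃ Φ : 𝓓((⊤ : Opens (Euc n × ℝ)), ℝ), ∀ ξ p, φ (ξ, p) = Φ ((ξ : Euc n), p)}
  zero_mem' := ⟨0, fun _ _ => rfl⟩
  add_mem' := by
    rintro φ ψ ⟨Φ, hΦ⟩ ⟨Ψ, hΨ⟩
    exact ⟨Φ + Ψ, fun ξ p => by simp [hΦ, hΨ]⟩
  smul_mem' := by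
    rintro c φ ⟨Φ, hΦ⟩
    exact ⟨c • Φ, fun ξ p => by simp [hΦ]⟩

/-- Elements of `C_c^∞(S^{n-1} × ℝ)` are functions on `S^{n-1} × ℝ`. -/
instance (n : ℕ) : FunLike (CylTest n) (Sph n × ℝ) ℝ where
  coe φ := φ.1
  coe_injective := Subtype.coe_injective

/-- The dual Radon transform `(R^* φ)(x) = ∫_{S^{n-1}} φ(ξ, ⟨x, ξ⟩) dξ`, where `dξ` is the
surface measure on the sphere. -/
noncomputable def dualRadon {n : ℕ} (φ : Sph n × ℝ → ℝ) (x : Euc n) : ℝ :=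
  ∫ ξ : Sph n, φ (ξ, inner ℝ x (ξ : Euc n)) ∂(volume : Measure (Euc n)).toSphere

lemma contDiff_integral_sphere {n : ℕ} (k : ℕ) :
    ∀ {F : Type} [NormedAddCommGroup F] [NormedSpace ℝ F] (g : Euc n × Euc n → F),
      ContDiff ℝ ∞ g →
      ContDiff ℝ k (fun x => ∫ ξ : Sph n, g (ξ, x) ∂(volume : Measure (Euc n)).toSphere) := by
  induction k with
  | zero =>
    intro F _ _ g hg
    simp only [Nat.cast_zero, contDiff_zero]
    have h : Continuous (Function.uncurry fun (x : Euc n) (ξ : Sph n) => g (ξ, x)) :=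
      hg.continuous.comp (by fun_prop)
    have := continuous_parametric_integral_of_continuous
      (μ := (volume : Measure (Euc n)).toSphere) h (isCompact_univ (X := Sph n))
    simpa using this
  | succ k ih =>
    intro F _ _ g hg
    have hg' : ContDiff ℝ ∞ (fun z : Euc n × Euc n =>
        (fderiv ℝ g z).comp (ContinuousLinearMap.inr ℝ (Euc n) (Euc n))) :=
      (hg.fderiv_right (m := ∞) (by simp)).clm_comp contDiff_const
    have hd : ∀ ξ x : Euc n, HasFDerivAt (fun y => g (ξ, y))
        ((fderiv ℝ g (ξ, x)).comp (ContinuousLinearMap.inr ℝ (Euc n) (Euc n))) x := fun ξ x =>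
      ((hg.differentiable (by simp)) (ξ, x)).hasFDerivAt.comp x (hasFDerivAt_prodMk_right ξ x)
    have hint : ∀ {F' : Type} [NormedAddCommGroup F'] (G : Euc n × Euc n → F') (x : Euc n),
        Continuous G → Integrable (fun ξ : Sph n => G (ξ, x))
          (volume : Measure (Euc n)).toSphere := by
      intro F' _ G x hG
      have hc : Continuous (fun ξ : Sph n => G (ξ, x)) := hG.comp (by fun_prop)
      exact hc.integrable_of_hasCompactSupport (HasCompactSupport.of_compactSpace _)
    rw [Nat.cast_add, Nat.cast_one, contDiff_succ_iff_hasFDerivAt]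
    refine ⟨_, ih _ hg', fun x => ?_⟩
    obtain ⟨C, hC⟩ := ((isCompact_sphere (0 : Euc n) 1).prod
      (isCompact_closedBall x 1)).exists_bound_of_continuousOn hg'.continuous.continuousOn
    refine hasFDerivAt_integral_of_dominated_of_fderiv_le (bound := fun _ => C)
      (F' := fun y (ξ : Sph n) =>
        (fderiv ℝ g (ξ, y)).comp (ContinuousLinearMap.inr ℝ (Euc n) (Euc n)))
      (Metric.closedBall_mem_nhds x one_pos) ?_ (hint g x hg.continuous)
      (hint _ x hg'.continuous).aestronglyMeasurable ?_ (integrable_const C) ?_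
    · exact Filter.Eventually.of_forall fun y => (hint g y hg.continuous).aestronglyMeasurable
    · exact Filter.Eventually.of_forall fun ξ y hy => hC (ξ, y) ⟨ξ.2, hy⟩
    · exact Filter.Eventually.of_forall fun ξ y _ => hd ξ y

/-- The dual Radon transform of a test function is smooth. -/
lemma contDiff_dualRadon {n : ℕ} (φ : CylTest n) : ContDiff ℝ ∞ (dualRadon (φ : _ → ℝ)) := by
  obtain ⟨Φ, hΦ⟩ := φ.2
  have h : dualRadon (φ : _ → ℝ) = fun x => ∫ ξ : Sph n,
      (fun z : Euc n × Euc n => Φ (z.1, inner ℝ z.2 z.1)) (ξ, x)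
        ∂(volume : Measure (Euc n)).toSphere := by
    funext x
    exact integral_congr_ae (Filter.Eventually.of_forall fun ξ => hΦ ξ _)
  rw [h, contDiff_infty]
  intro k
  exact contDiff_integral_sphere k _
    (Φ.contDiff.comp (contDiff_fst.prodMk (contDiff_snd.inner ℝ contDiff_fst)))

lemma integrable_dualRadon {n : ℕ} (φ : CylTest n) (x : Euc n) :
    Integrable (fun ξ : Sph n => φ (ξ, inner ℝ x (ξ : Euc n)))
      (volume : Measure (Euc n)).toSphere := by
  obtain ⟨Φ, hΦ⟩ := φ.2
  have hc : Continuous (fun ξ : Sph n => φ (ξ, inner ℝ x (ξ : Euc n))) := by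
    have : (fun ξ : Sph n => φ (ξ, inner ℝ x (ξ : Euc n))) =
        fun ξ : Sph n => Φ ((ξ : Euc n), inner ℝ x (ξ : Euc n)) := funext fun ξ => hΦ ξ _
    rw [this]
    exact Φ.continuous.comp (by fun_prop)
  exact hc.integrable_of_hasCompactSupport (HasCompactSupport.of_compactSpace _)

lemma exists_cutoff {n : ℕ} {K : Set (Euc n)} (hK : IsCompact K) :
    ∃ χ : 𝓓((⊤ : Opens (Euc n)), ℝ), ∀ᶠ x in 𝓝ˢ K, χ x = 1 := by
  obtain ⟨r, hr, hKr⟩ := hK.isBounded.subset_ball_lt 0 (0 : Euc n)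
  let b : ContDiffBump (0 : Euc n) := ⟨r, r + 1, hr, by linarith⟩
  refine ⟨⟨b, b.contDiff, b.hasCompactSupport, fun _ _ => trivial⟩, ?_⟩
  filter_upwards [Metric.isOpen_ball.mem_nhdsSet.2 hKr] with x hx
  exact b.one_of_mem_closedBall (Metric.ball_subset_closedBall hx)

/-- A smooth compactly supported function on `ℝⁿ` that equals `1` near `K` (for compact `K`). -/
noncomputable def cutoff {n : ℕ} (K : Set (Euc n)) : 𝓓((⊤ : Opens (Euc n)), ℝ) :=
  Classical.epsilon fun χ => ∀ᶠ x in 𝓝ˢ K, χ x = 1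

lemma cutoff_spec {n : ℕ} {K : Set (Euc n)} (hK : IsCompact K) :
    ∀ᶠ x in 𝓝ˢ K, cutoff K x = 1 :=
  Classical.epsilon_spec (exists_cutoff hK)

/-- The test function `χ · R^* φ` on `ℝⁿ`. -/
noncomputable def cutDualRadon {n : ℕ} (χ : 𝓓((⊤ : Opens (Euc n)), ℝ)) (φ : CylTest n) :
    𝓓((⊤ : Opens (Euc n)), ℝ) where
  toFun x := χ x * dualRadon (φ : _ → ℝ) x
  contDiff' := χ.contDiff.mul (contDiff_dualRadon φ)
  hasCompactSupport' := χ.hasCompactSupport.mul_right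
  tsupport_subset' := fun _ _ => trivial

/-- The Radon transform of a compactly supported distribution `f` on `ℝⁿ`, as a linear functional
on `C_c^∞(S^{n-1} × ℝ)`: `⟨R f, φ⟩ = ⟨f, R^* φ⟩`, where `f` acts on the smooth function `R^* φ`
through any smooth cutoff `χ` that equals `1` near the support of `f`,
`⟨f, R^* φ⟩ = ⟨f, χ · R^* φ⟩`. -/
noncomputable def radonTransform {n : ℕ} (f : 𝓓'((⊤ : Opens (Euc n)), ℂ)) :
    CylTest n →ₗ[ℝ] ℂ where
  toFun φ := f (cutDualRadon (cutoff (dsupport f)) φ)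
  map_add' φ ψ := by
    rw [← map_add]
    congr 1
    ext x
    change _ * dualRadon _ x = _ * dualRadon _ x + _ * dualRadon _ x
    rw [← mul_add]
    congr 1
    exact integral_add (integrable_dualRadon φ x) (integrable_dualRadon ψ x)
  map_smul' c φ := by
    rw [RingHom.id_apply, ← map_smul]
    congr 1
    ext x
    change _ * dualRadon _ x = c * (_ * dualRadon _ x)
    rw [mul_left_comm]
    congr 1
    exact integral_const_mul c _

/-- A distribution vanishes on the test functions supported away from its support. -/
lemma isVanishingOn_compl_dsupport {n : ℕ} (f : 𝓓'((⊤ : Opens (Euc n)), ℂ)) :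
    IsVanishingOn f (dsupport f)ᶜ := by
  intro ψ hψ
  have hloc : ∀ x : Euc n, ∃ U : Set (Euc n), IsOpen U ∧ IsVanishingOn f U ∧
      (x ∈ tsupport ψ → x ∈ U) := by
    intro x
    by_cases hx : x ∈ tsupport ψ
    · obtain ⟨U, h1, h2, h3⟩ := (notMem_dsupport_iff (f := (f : _ → ℂ)) x).1 (hψ hx)
      exact ⟨U, h2, h1, fun _ => h3⟩
    · refine ⟨∅, isOpen_empty, fun u hu => ?_, fun h => absurd h hx⟩
      have : u = 0 := by
        ext y
        exact image_eq_zero_of_notMem_tsupport fun hy => hu hy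
      rw [this, map_zero]
  choose U hUo hUv hU using hloc
  obtain ⟨t, ht⟩ := ψ.hasCompactSupport.isCompact.elim_nhds_subcover' (fun x _ => U x)
    (fun x hx => (hUo x).mem_nhds (hU x hx))
  have hcov : tsupport ψ ⊆ ⋃ i : t, U i := by
    intro x hx
    obtain ⟨i, hi, hx'⟩ := Set.mem_iUnion₂.1 (ht hx)
    exact Set.mem_iUnion.2 ⟨⟨i, hi⟩, hx'⟩
  obtain ⟨ρ, hρ⟩ := SmoothPartitionOfUnity.exists_isSubordinate (modelWithCornersSelf ℝ (Euc n))
    (isClosed_tsupport ψ) (fun i : t => U i) (fun i => hUo i) hcov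
  let u : t → 𝓓((⊤ : Opens (Euc n)), ℝ) := fun i =>
    ⟨fun x => ρ i x * ψ x, (ρ i).contMDiff.contDiff.mul ψ.contDiff,
      ψ.hasCompactSupport.mul_left, fun _ _ => trivial⟩
  have hsum : ψ = ∑ i, u i := by
    ext x
    have h1 : (∑ i, u i) x = ∑ i, ρ i x * ψ x := by
      rw [← FunLike.coeAddMonoidHom_apply, map_sum, Finset.sum_apply]
      rfl
    rw [h1, ← Finset.sum_mul]
    by_cases hx : x ∈ tsupport ψ
    · rw [← finsum_eq_sum_of_fintype, ρ.sum_eq_one hx, one_mul]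
    · rw [image_eq_zero_of_notMem_tsupport hx, mul_zero]
  rw [hsum, map_sum]
  exact Finset.sum_eq_zero fun i _ =>
    hUv i (u i) ((tsupport_mul_subset_left).trans (hρ i))

/-- The Radon transform does not depend on the choice of the cutoff. -/
lemma radonTransform_apply {n : ℕ} (f : 𝓓'((⊤ : Opens (Euc n)), ℂ))
    (hf : IsCompact (dsupport f)) (χ : 𝓓((⊤ : Opens (Euc n)), ℝ))
    (hχ : ∀ᶠ x in 𝓝ˢ (dsupport f), χ x = 1) (φ : CylTest n) :
    radonTransform f φ = f (cutDualRadon χ φ) := by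
  change f _ = f _
  rw [← sub_eq_zero, ← map_sub]
  refine isVanishingOn_compl_dsupport f _ fun x hx hxf => ?_
  have h : ∀ᶠ y in 𝓝 x, cutoff (dsupport f) y = χ y := by
    filter_upwards [Filter.Eventually.filter_mono (nhds_le_nhdsSet hxf) (cutoff_spec hf),
      Filter.Eventually.filter_mono (nhds_le_nhdsSet hxf) hχ] with y h1 h2
    rw [h1, h2]
  refine (notMem_tsupport_iff_eventuallyEq.2 ?_) hx
  filter_upwards [h] with y hy
  change cutoff (dsupport f) y * dualRadon (φ : _ → ℝ) y - χ y * dualRadon (φ : _ → ℝ) y = 0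
  rw [hy, sub_self]

/-- The pairs `(ξ, p) ∈ S^{n-1} × ℝ` for which the hyperplane `{x | ⟨x, ξ⟩ = p}` is a supporting
plane to `D`: it meets the closure of `D` and `D` lies in one of its two closed half-spaces. -/
def supportingPlanes {n : ℕ} (D : Set (Euc n)) : Set (Sph n × ℝ) :=
  {z | (∃ x ∈ closure D, inner ℝ x (z.1 : Euc n) = z.2) ∧
    ((∀ x ∈ D, inner ℝ x (z.1 : Euc n) ≤ z.2) ∨ (∀ x ∈ D, z.2 ≤ inner ℝ x (z.1 : Euc n)))}

/-- An ellipsoid (as a hypersurface): the image of the unit sphere under an invertible affine map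
of `ℝⁿ`. -/
def IsEllipsoid {n : ℕ} (S : Set (Euc n)) : Prop :=
  ∃ A : Euc n ≃ᵃ[ℝ] Euc n, S = A '' Metric.sphere (0 : Euc n) 1

end RadonSupport

/-! Fix a real functional `T` obtained from the distribution by a cutoff and a real-linear form on
`ℂ`. For each `w`, push `T` forward under `x ↦ ⟨x, w⟩`, that is, apply it to the ridge functions `x
↦ g ⟨x, w⟩`. Testing the Radon transform against products of a bump on the sphere and a function of
`p` shows that this push-forward is supported in the two extreme values `ρ₁ w = h w` and `ρ₂ w = -h
(-w)`, where `h` is the support function of `D` (`exists_cutDistribution_ridge_eq_zero`,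
`HasOrderOn.apply_ridge_eq_zero_of_local`). As the order is at most some `N`, the polynomial `((X -
ρ₁ w) (X - ρ₂ w)) ^ (N + 1)` annihilates it.

The rest is algebra over `ℝ[w]`. The moments `T ⟨x, w⟩ ^ k` are polynomials in `w`
(`exists_moment_polynomial`), so they define one functional on `ℝ[w][X]`. By Noetherianity and
Gauss's lemma its annihilator contains a monic `Q` of minimal degree, and at generic `w` the
specialization of `Q` divides the polynomial above, so it is `(X - ρ₁ w) ^ i (X - ρ₂ w) ^ j`
(`exists_generic_factorization`). For `n > 1` the multiplicity `i` is constant by connectedness of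
`ℝⁿ \ {0}`, and the symmetry `w ↦ -w`, which exchanges the roots up to sign, forces `i = j`. The
coefficients of `Q` then show that `ρ₁ + ρ₂` and `(ρ₁ - ρ₂) ^ 2` are smooth; being homogeneous of
degree one and two, they are a linear and a quadratic form (`linear_and_quadratic_of_moments`).
Hence `h w = ⟨c, w⟩ + ‖S w‖ / 2` with `S` linear and invertible, which is the support function of an
affine image of the ball (`isEllipsoid_frontier`).

The moments are not all zero: otherwise density of the polynomials makes `T` vanish on every ridge
function, and Fourier inversion, which writes a test function as a superposition of ridge functions,
makes `T` vanish on test functions. -/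

namespace RadonSupport

/-! ### Minimal annihilators of functionals on `R[X]` and their specializations. -/

open Polynomial

/-- A linear functional on `R[X]` whose annihilator is detected by finitely many test powers has a
monic element in its annihilator. -/
lemma exists_monic_annihilator {R : Type*} [CommRing R] [IsNoetherianRing R]
    (L : R[X] →ₗ[R] R) (D : ℕ)
    (hL : ∀ Q : R[X], (∀ j < D, L (Q * X ^ j) = 0) → ∀ P, L (Q * P) = 0) :
    ∃ A : R[X], A.Monic ∧ ∀ P, L (A * P) = 0 := by
  let Θ : R[X] →ₗ[R] (Fin D → R) :=
    LinearMap.pi fun j => L.comp (LinearMap.mulRight R (X ^ (j : ℕ)))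
  have hΘ : ∀ Q, Θ Q = 0 → ∀ P, L (Q * P) = 0 := by
    intro Q hQ
    refine hL Q fun j hj => ?_
    simpa [Θ] using congrFun hQ ⟨j, hj⟩
  let V : ℕ →o Submodule R (Fin D → R) :=
    ⟨fun k => (degreeLT R k).map Θ, fun a b hab => Submodule.map_mono (degreeLT_mono hab)⟩
  obtain ⟨k, hk⟩ := monotone_stabilizes_iff_noetherian.2 (inferInstance :
    IsNoetherian R (Fin D → R)) V
  -- Where the chain stops, `X ^ k` has the same image as some `B` of degree below `k`; the
  -- difference is monic and lies in the kernel of `Θ`.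
  have h1 : Θ (X ^ k) ∈ V k := by
    rw [hk (k + 1) (Nat.le_succ k)]
    exact ⟨X ^ k, mem_degreeLT.2 (lt_of_le_of_lt (degree_X_pow_le k)
      (by exact_mod_cast k.lt_succ_self)), rfl⟩
  obtain ⟨B, hB, hBe⟩ := h1
  nontriviality R
  refine ⟨X ^ k - B, (monic_X_pow k).sub_of_left (by simpa using mem_degreeLT.1 hB), hΘ _ ?_⟩
  rw [map_sub, hBe, sub_self]

/-- If the annihilator of a functional on `R[X]` contains a monic polynomial, then it has a monic
element of minimal degree. -/
lemma exists_monic_minimal_annihilator {R : Type*} [CommRing R] [IsDomain R]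
    [UniqueFactorizationMonoid R] (L : R[X] →ₗ[R] R) (A : R[X]) (hA : A.Monic)
    (hAL : ∀ P, L (A * P) = 0) :
    ∃ Q : R[X], Q.Monic ∧ (∀ P, L (Q * P) = 0) ∧
      ∀ B : R[X], B ≠ 0 → (∀ P, L (B * P) = 0) → Q.natDegree ≤ B.natDegree := by
  classical
  obtain ⟨iN⟩ : Nonempty (NormalizedGCDMonoid R) :=
    inferInstance
  let S : Set ℕ := {k | ∃ B : R[X], B ≠ 0 ∧ (∀ P, L (B * P) = 0) ∧ B.natDegree = k}
  have hS : S.Nonempty := ⟨_, A, hA.ne_zero, hAL, rfl⟩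
  obtain ⟨B, hB0, hBL, hBd⟩ := Nat.sInf_mem hS
  have hmin : ∀ B' : R[X], B' ≠ 0 → (∀ P, L (B' * P) = 0) → sInf S ≤ B'.natDegree :=
    fun B' h0 hL => Nat.sInf_le ⟨B', h0, hL, rfl⟩
  have hpL : ∀ P, L (B.primPart * P) = 0 := by
    intro P
    have h := hBL P
    rw [B.eq_C_content_mul_primPart, mul_assoc, ← smul_eq_C_mul, map_smul, smul_eq_mul] at h
    exact (mul_eq_zero.1 h).resolve_left (content_eq_zero_iff.not.2 hB0)
  set p := B.primPart with hp
  have hpp : p.IsPrimitive := B.isPrimitive_primPart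
  have hpd : p.natDegree = sInf S := by rw [hp, natDegree_primPart, hBd]
  let K := FractionRing R
  have hinj : Function.Injective (algebraMap R K) := IsFractionRing.injective R K
  -- Clearing denominators in the division of `A` by `p` over the fraction field gives the
  -- annihilator `C b * A - p * q'` of degree below that of `p`; by minimality it is zero.
  have hdvd : p.map (algebraMap R K) ∣ A.map (algebraMap R K) := by
    have hp0 : p.map (algebraMap R K) ≠ 0 := by
      rw [Ne, Polynomial.map_eq_zero_iff hinj]; exact hpp.ne_zero
    rw [← EuclideanDomain.mod_eq_zero]
    set q := A.map (algebraMap R K) / p.map (algebraMap R K) with hq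
    set r := A.map (algebraMap R K) % p.map (algebraMap R K) with hr
    have hdm : p.map (algebraMap R K) * q + r = A.map (algebraMap R K) :=
      EuclideanDomain.div_add_mod _ _
    obtain ⟨b, hb, hbq⟩ := IsLocalization.integerNormalization_spec (nonZeroDivisors R) q
    have hb0 : algebraMap R K b ≠ 0 := by
      rw [Ne, map_eq_zero_iff _ hinj]; exact nonZeroDivisors.ne_zero hb
    set q' := IsLocalization.integerNormalization (nonZeroDivisors R) q
    have hr' : (C b * A - p * q').map (algebraMap R K) = C (algebraMap R K b) * r := by
      rw [Polynomial.map_sub, Polynomial.map_mul, Polynomial.map_mul, map_C, hbq, ← hdm,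
        Algebra.smul_def, Polynomial.algebraMap_apply]
      ring
    have hdeg : (C b * A - p * q').degree < p.degree := by
      rw [← degree_map_eq_of_injective hinj, hr', degree_C_mul hb0,
        ← degree_map_eq_of_injective hinj p]
      exact EuclideanDomain.mod_lt _ hp0
    have hzero : C b * A - p * q' = 0 := by
      by_contra hne
      refine absurd (hmin _ hne fun P => ?_) (not_le.2 ?_)
      · rw [sub_mul, map_sub, mul_assoc, ← smul_eq_C_mul, map_smul, hAL, mul_assoc, hpL, smul_zero,
          sub_zero]
      · rw [← hpd]
        exact natDegree_lt_natDegree hne hdeg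
    rw [hzero, Polynomial.map_zero] at hr'
    exact (mul_eq_zero.1 hr'.symm).resolve_left (C_ne_zero.2 hb0)
  -- Gauss's lemma: the primitive `p` divides the monic `A` already over `R`, so its leading
  -- coefficient is a unit.
  obtain ⟨c, hc⟩ := hpp.dvd_of_fraction_map_dvd_fraction_map hdvd
  have hu : IsUnit p.leadingCoeff := by
    refine IsUnit.of_mul_eq_one c.leadingCoeff ?_
    rw [← leadingCoeff_mul, ← hc, hA.leadingCoeff]
  refine ⟨C (↑hu.unit⁻¹ : R) * p, ?_, fun P => ?_, fun B' h0 hL => ?_⟩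
  · rw [Monic, leadingCoeff_mul, leadingCoeff_C]
    exact hu.val_inv_mul
  · rw [mul_assoc, ← smul_eq_C_mul, map_smul, hpL, smul_zero]
  · rw [natDegree_C_mul (Units.ne_zero _), hpd]
    exact hmin B' h0 hL

/-- Two polynomials of small degree annihilate a functional as soon as they do so on the powers
below the degree of a monic annihilator. -/
lemma annihilates_of_forall_pow_lt {R : Type*} [CommRing R] (L : R[X] →ₗ[R] R) {Q : R[X]}
    (hQ : Q.Monic) (hQL : ∀ P, L (Q * P) = 0) {q : R[X]} {d : ℕ} (hd : Q.natDegree ≤ d)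
    (hq : ∀ j < d, L (q * X ^ j) = 0) (P : R[X]) : L (q * P) = 0 := by
  nontriviality R
  rw [← modByMonic_add_div P Q, mul_add, map_add, ← mul_assoc, mul_comm q Q, mul_assoc, hQL,
    add_zero]
  by_cases h1 : Q = 1
  · simp [h1]
  have hlt := natDegree_modByMonic_lt P hQ h1
  rw [as_sum_range_C_mul_X_pow (P %ₘ Q), Finset.mul_sum, map_sum]
  refine Finset.sum_eq_zero fun j hj => ?_
  rw [mul_left_comm, ← smul_eq_C_mul, map_smul, hq j, smul_zero]
  have := Finset.mem_range.1 hj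
  omega

/-- Generic specialization of the minimal annihilator: outside the zero set of some nonzero `δ`,
the specialization of `Q` divides every annihilator of the specialized functional. -/
lemma exists_generic_dvd {R : Type} [CommRing R] [IsDomain R] (L : R[X] →ₗ[R] R) {Q : R[X]}
    (hQ : Q.Monic) (hQL : ∀ P, L (Q * P) = 0)
    (hmin : ∀ B : R[X], B ≠ 0 → (∀ P, L (B * P) = 0) → Q.natDegree ≤ B.natDegree) :
    ∃ δ : R, δ ≠ 0 ∧ ∀ {k : Type} [Field k] (φ : R →+* k) (Lφ : k[X] →ₗ[k] k),
      (∀ P, Lφ (P.map φ) = φ (L P)) → φ δ ≠ 0 →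
      ∀ q : k[X], (∀ P, Lφ (q * P) = 0) → Q.map φ ∣ q := by
  classical
  set d := Q.natDegree with hd
  let H : Matrix (Fin d) (Fin d) R := Matrix.of fun i j => L (X ^ (i + j : ℕ))
  have key : ∀ {S : Type} [CommRing S] (M : S[X] →ₗ[S] S) (v : Fin d → S) (i : Fin d),
      M ((∑ j : Fin d, C (v j) * X ^ (j : ℕ)) * X ^ (i : ℕ)) =
        ((Matrix.of fun i j : Fin d => M (X ^ (i + j : ℕ))).mulVec v) i := by
    intro S _ M v i
    rw [Finset.sum_mul, map_sum]
    simp only [Matrix.mulVec, dotProduct, Matrix.of_apply]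
    refine Finset.sum_congr rfl fun j _ => ?_
    rw [mul_assoc, ← pow_add, ← smul_eq_C_mul, map_smul, smul_eq_mul, mul_comm, add_comm]
  -- A null vector of the Hankel matrix `H` is the coefficient vector of an annihilator of degree
  -- below `d`, which minimality of `Q` excludes. Where the determinant survives specialization, the
  -- same reasoning kills the remainder of `q` modulo `Q.map φ`.
  refine ⟨H.det, fun h0 => ?_, ?_⟩
  · obtain ⟨v, hv, hHv⟩ := Matrix.exists_mulVec_eq_zero_iff.2 h0
    set B : R[X] := ∑ j : Fin d, C (v j) * X ^ (j : ℕ) with hB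
    have hcoeff : ∀ j : Fin d, B.coeff j = v j := by
      intro j
      simp [hB, coeff_X_pow, Fin.val_inj]
    have hB0 : B ≠ 0 := by
      intro h
      apply hv
      ext j
      rw [← hcoeff, h]; simp
    have hBd : B.degree < d := degree_sum_fin_lt v
    refine absurd (hmin B hB0 (annihilates_of_forall_pow_lt L hQ hQL hd.symm.le fun j hj => ?_))
      (not_le.2 ((natDegree_lt_iff_degree_lt hB0).2 hBd))
    have := key L v ⟨j, hj⟩
    rw [← hB] at this
    rw [this]
    exact congrFun hHv ⟨j, hj⟩
  · intro k _ φ Lφ hφ hδ q hq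
    have hQm : (Q.map φ).Monic := hQ.map φ
    rw [← modByMonic_eq_zero_iff_dvd hQm]
    set r := q %ₘ Q.map φ with hr
    have hQφ : ∀ P, Lφ (Q.map φ * P) = 0 := by
      intro P
      rw [as_sum_range_C_mul_X_pow P, Finset.mul_sum, map_sum]
      refine Finset.sum_eq_zero fun j _ => ?_
      have hj : Q.map φ * X ^ j = (Q * X ^ j).map φ := by simp
      rw [mul_left_comm, ← smul_eq_C_mul, map_smul, hj, hφ, hQL, map_zero, smul_zero]
    have hrL : ∀ P, Lφ (r * P) = 0 := by
      intro P
      have h := hq P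
      rwa [← modByMonic_add_div q (Q.map φ), add_mul, map_add, mul_assoc, hQφ, add_zero] at h
    have hrd : r.degree < d := by
      have := degree_modByMonic_lt q hQm
      rwa [degree_eq_natDegree hQm.ne_zero, hQ.natDegree_map] at this
    have hrs : r = ∑ j : Fin d, C (r.coeff j) * X ^ (j : ℕ) := by
      rw [Fin.sum_univ_eq_sum_range fun j => C (r.coeff j) * X ^ j]
      ext i
      simp only [finsetSum_coeff, coeff_C_mul, coeff_X_pow, mul_ite, mul_one, mul_zero,
        Finset.sum_ite_eq, Finset.mem_range]
      split_ifs with hi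
      · rfl
      · exact coeff_eq_zero_of_degree_lt (hrd.trans_le (by exact_mod_cast not_lt.1 hi))
    have hdet : (H.map φ).det ≠ 0 := by rwa [← RingHom.mapMatrix_apply, ← RingHom.map_det]
    have hv : (fun j : Fin d => r.coeff j) = 0 := by
      refine Matrix.eq_zero_of_mulVec_eq_zero hdet ?_
      ext i
      have h := key Lφ (fun j : Fin d => r.coeff j) i
      rw [← hrs, hrL] at h
      rw [Pi.zero_apply, h]
      congr 1
      ext a b
      simp only [H, Matrix.map_apply, Matrix.of_apply, ← hφ, Polynomial.map_pow, map_X]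
    rw [hrs]
    exact Finset.sum_eq_zero fun j _ => by rw [congrFun hv j]; simp

/-- The monic divisors of `((X - a) (X - b)) ^ m`. -/
lemma eq_pow_mul_pow_of_dvd {k : Type*} [Field k] {a b : k} {m : ℕ} {Q : k[X]} (hQ : Q.Monic)
    (h : Q ∣ ((X - C a) * (X - C b)) ^ m) :
    ∃ i j : ℕ, Q = (X - C a) ^ i * (X - C b) ^ j := by
  rw [mul_pow] at h
  obtain ⟨A, B, hA, hB, rfl⟩ := exists_dvd_and_dvd_of_dvd_mul h
  obtain ⟨i, -, hi⟩ := (dvd_prime_pow (prime_X_sub_C a) m).1 hA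
  obtain ⟨j, -, hj⟩ := (dvd_prime_pow (prime_X_sub_C b) m).1 hB
  refine ⟨i, j, eq_of_monic_of_associated hQ ?_ (hi.mul_mul hj)⟩
  exact ((monic_X_sub_C a).pow i).mul ((monic_X_sub_C b).pow j)

/-- The second coefficient gives the sum of the roots with multiplicity, which is therefore
polynomial in `w` when the coefficients are. -/
lemma coeff_pow_mul_pow {k : Type*} [Field k] (a b : k) (i j : ℕ) :
    ((X - C a) ^ i * (X - C b) ^ j : k[X]).natDegree = i + j ∧
    ((X - C a) ^ i * (X - C b) ^ j : k[X]).nextCoeff = -(i * a + j * b) := by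
  have hm1 := (monic_X_sub_C a).pow i
  have hm2 := (monic_X_sub_C b).pow j
  constructor
  · rw [hm1.natDegree_mul hm2, (monic_X_sub_C a).natDegree_pow, (monic_X_sub_C b).natDegree_pow]
    simp
  · rw [hm1.nextCoeff_mul hm2, (monic_X_sub_C a).nextCoeff_pow, (monic_X_sub_C b).nextCoeff_pow]
    simp
    ring

/-- Multiplication by `X ^ 2 - (a + b) X + a b` is a three-term recurrence on coefficients, so the
top three have to be carried through the induction together. The third one recovers `a * b` once `a
+ b` is known. -/
lemma coeff_pow_quadratic (a b : ℝ) (i : ℕ) :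
    (((X - C a) * (X - C b)) ^ (i + 1) : ℝ[X]).coeff (2 * i + 2) = 1 ∧
    (((X - C a) * (X - C b)) ^ (i + 1) : ℝ[X]).coeff (2 * i + 1) = -((i + 1) * (a + b)) ∧
    (((X - C a) * (X - C b)) ^ (i + 1) : ℝ[X]).coeff (2 * i) =
      (i + 1) * (a * b) + (i + 1) * i / 2 * (a + b) ^ 2 := by
  have hq : ((X - C a) * (X - C b) : ℝ[X]) = X ^ 2 - C (a + b) * X + C (a * b) := by
    simp only [C_add, C_mul]; ring
  have hc : ∀ (P : ℝ[X]) (n : ℕ), (P * ((X - C a) * (X - C b))).coeff (n + 2) =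
      P.coeff n - (a + b) * P.coeff (n + 1) + a * b * P.coeff (n + 2) := by
    intro P n
    rw [hq, mul_add, mul_sub, ← mul_assoc, mul_comm P (C (a + b)), coeff_add, coeff_sub,
      coeff_mul_X_pow, show n + 2 = (n + 1) + 1 from rfl, coeff_mul_X, coeff_C_mul, coeff_mul_C]
    ring
  induction i with
  | zero =>
    rw [zero_add, pow_one, hq]
    refine ⟨?_, ?_, ?_⟩ <;>
    simp [coeff_X, coeff_C]
  | succ i ih =>
    obtain ⟨h2, h1, h0⟩ := ih
    have hdeg : (((X - C a) * (X - C b)) ^ (i + 1) : ℝ[X]).natDegree = 2 * i + 2 := by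
      rw [natDegree_pow, natDegree_mul (X_sub_C_ne_zero a) (X_sub_C_ne_zero b)]
      simp; ring
    have h3 : (((X - C a) * (X - C b)) ^ (i + 1) : ℝ[X]).coeff (2 * i + 3) = 0 :=
      coeff_eq_zero_of_natDegree_lt (by omega)
    have h4 : (((X - C a) * (X - C b)) ^ (i + 1) : ℝ[X]).coeff (2 * i + 4) = 0 :=
      coeff_eq_zero_of_natDegree_lt (by omega)
    rw [pow_succ]
    refine ⟨?_, ?_, ?_⟩
    · rw [show 2 * (i + 1) + 2 = (2 * i + 2) + 2 by ring, hc, h2, h3, h4]; ring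
    · rw [show 2 * (i + 1) + 1 = (2 * i + 1) + 2 by ring, hc, h1, h2, h3]; push_cast; ring
    · rw [show 2 * (i + 1) = 2 * i + 2 by ring, hc, h0, h1, h2]; push_cast; ring

end RadonSupport

/-! ### Homogeneous functions and recurrences with polynomial moments. -/

namespace RadonSupport

open Polynomial

/-- A function that is positively homogeneous of degree one and differentiable at the origin is
linear. -/
lemma eq_fderiv_of_homogeneous {E F : Type*} [NormedAddCommGroup E] [NormedSpace ℝ E]
    [NormedAddCommGroup F] [NormedSpace ℝ F] {u : E → F} (hu : DifferentiableAt ℝ u 0)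
    (hh : ∀ c : ℝ, 0 < c → ∀ x, u (c • x) = c • u x) (x : E) : u x = fderiv ℝ u 0 x := by
  have h0 : u 0 = 0 := by
    have h := hh 2 two_pos 0
    rw [smul_zero, two_smul] at h
    simpa using h
  have h1 : HasDerivAt (fun t : ℝ => u (t • x)) (fderiv ℝ u 0 x) 0 := by
    have hl : HasDerivAt (fun t : ℝ => t • x) x 0 := by
      simpa using (hasDerivAt_id (0 : ℝ)).smul_const x
    have hu' : HasFDerivAt u (fderiv ℝ u 0) ((0 : ℝ) • x) := by
      simpa using hu.hasFDerivAt
    exact hu'.comp_hasDerivAt 0 hl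
  -- Homogeneity is available for positive factors only, hence a one-sided derivative, which still
  -- determines the derivative at `0`.
  have h2 : HasDerivWithinAt (fun t : ℝ => u (t • x)) (u x) (Set.Ici 0) 0 := by
    have hl : HasDerivWithinAt (fun t : ℝ => t • u x) (u x) (Set.Ici 0) 0 := by
      simpa using ((hasDerivAt_id (0 : ℝ)).smul_const (u x)).hasDerivWithinAt
    refine hl.congr (fun t ht => ?_) (by simp [h0])
    rcases (Set.mem_Ici.1 ht).eq_or_lt with rfl | ht
    · simp [h0]
    · exact hh t ht x
  exact (uniqueDiffWithinAt_Ici (0 : ℝ)).eq_deriv _ h2 h1.hasDerivWithinAt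

/-- A smooth function that is positively homogeneous of degree two is a quadratic form. -/
lemma exists_bilin_of_homogeneous {E : Type*} [NormedAddCommGroup E] [NormedSpace ℝ E]
    {u : E → ℝ} (hu : ContDiff ℝ 2 u)
    (hh : ∀ c : ℝ, 0 < c → ∀ x, u (c • x) = c ^ 2 * u x) :
    ∃ b : E →ₗ[ℝ] E →ₗ[ℝ] ℝ, ∀ x, u x = b x x := by
  have hd : Differentiable ℝ u := hu.differentiable (by norm_num)
  have hd' : Differentiable ℝ (fderiv ℝ u) :=
    (hu.fderiv_right (m := 1) (by norm_num)).differentiable (by norm_num)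
  have hD : ∀ c : ℝ, 0 < c → ∀ x, fderiv ℝ u (c • x) = c • fderiv ℝ u x := by
    intro c hc x
    have h1 : HasFDerivAt (fun y => u (c • y)) (c • fderiv ℝ u (c • x)) x := by
      have hs : HasFDerivAt (fun y : E => c • y) (c • ContinuousLinearMap.id ℝ E) x :=
        (hasFDerivAt_id x).const_smul c
      have := (hd (c • x)).hasFDerivAt.comp x hs
      exact this.congr_fderiv (by ext; simp)
    have h2 : HasFDerivAt (fun y => u (c • y)) (c ^ 2 • fderiv ℝ u x) x := by
      have : (fun y => u (c • y)) = fun y => c ^ 2 * u y := funext (hh c hc)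
      rw [this]
      exact (hd x).hasFDerivAt.const_mul (c ^ 2)
    have h := h1.unique h2
    rw [pow_two, mul_smul] at h
    exact smul_right_injective _ hc.ne' h
  -- The derivative is homogeneous of degree one, hence linear; Euler's identity then recovers `u`.
  have hlin := eq_fderiv_of_homogeneous (hd' 0) hD
  have heuler : ∀ x, fderiv ℝ u x x = 2 * u x := by
    intro x
    have h1 : HasDerivAt (fun t : ℝ => u (t • x)) (fderiv ℝ u x x) 1 := by
      have hl : HasDerivAt (fun t : ℝ => t • x) x 1 := by
        simpa using (hasDerivAt_id (1 : ℝ)).smul_const x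
      have hu' : HasFDerivAt u (fderiv ℝ u x) ((1 : ℝ) • x) := by
        simpa using (hd x).hasFDerivAt
      exact hu'.comp_hasDerivAt 1 hl
    have h2 : HasDerivAt (fun t : ℝ => u (t • x)) (2 * u x) 1 := by
      have hl : HasDerivAt (fun t : ℝ => t ^ 2 * u x) (2 * u x) 1 := by
        simpa using (hasDerivAt_pow 2 (1 : ℝ)).mul_const (u x)
      refine hl.congr_of_eventuallyEq ?_
      filter_upwards [lt_mem_nhds (one_pos : (0 : ℝ) < 1)] with t ht
      exact hh t ht x
    exact h1.unique h2
  refine ⟨LinearMap.mk₂ ℝ (fun x y => (1 / 2 : ℝ) * fderiv ℝ (fderiv ℝ u) 0 x y)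
    (by intros; simp; ring) (by intros; simp; ring) (by intros; simp; ring)
    (by intros; simp; ring), fun x => ?_⟩
  rw [LinearMap.mk₂_apply, ← hlin, heuler]
  ring

/-- Every ball contains a product of intervals, and a polynomial that vanishes on a product of
infinite sets is zero. -/
lemma dense_eval_ne_zero {n : ℕ} {δ : MvPolynomial (Fin n) ℝ} (hδ : δ ≠ 0) :
    Dense {w : Euc n | MvPolynomial.eval w δ ≠ 0} := by
  rw [Metric.dense_iff]
  intro w r hr
  by_contra hne
  apply hδ
  have hopen : IsOpen ((fun v : Fin n → ℝ => (WithLp.toLp 2 v : Euc n)) ⁻¹' Metric.ball w r) :=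
    Metric.isOpen_ball.preimage (PiLp.continuous_toLp 2 _)
  obtain ⟨ε, hε, hsub⟩ := Metric.isOpen_iff.1 hopen (w : Fin n → ℝ) (by simpa using hr)
  refine MvPolynomial.funext_set (fun i => Metric.ball (w i) ε)
    (fun i => ?_) fun x hx => ?_
  · rw [Real.ball_eq_Ioo]
    exact Set.Ioo_infinite (by linarith)
  · rw [map_zero]
    by_contra h0
    refine hne ⟨WithLp.toLp 2 x, hsub ?_, h0⟩
    rw [← ball_pi _ hε] at hx
    exact hx

lemma contDiff_eval {n : ℕ} (p : MvPolynomial (Fin n) ℝ) :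
    ContDiff ℝ ∞ (fun w : Euc n => MvPolynomial.eval w p) := by
  induction p using MvPolynomial.induction_on with
  | C a => simpa using contDiff_const
  | add p q hp hq => simpa using hp.add hq
  | mul_X p i hp =>
    simp only [map_mul, MvPolynomial.eval_X]
    exact hp.mul (by fun_prop)

/-- The functional on `ℝ[w][X]` with prescribed moments. -/
noncomputable def momentFunctional {n : ℕ} (M : ℕ → MvPolynomial (Fin n) ℝ) :
    (MvPolynomial (Fin n) ℝ)[X] →ₗ[MvPolynomial (Fin n) ℝ] MvPolynomial (Fin n) ℝ :=
  (basisMonomials _).constr (MvPolynomial (Fin n) ℝ) M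

lemma momentFunctional_X_pow {n : ℕ} (M : ℕ → MvPolynomial (Fin n) ℝ) (k : ℕ) :
    momentFunctional M (X ^ k) = M k := by
  rw [← monomial_one_right_eq_X_pow, momentFunctional]
  simpa using (basisMonomials _).constr_basis (MvPolynomial (Fin n) ℝ) M k

/-- This is the compatibility with specialization that `exists_generic_dvd` requires. -/
lemma eval_momentFunctional {n : ℕ} {M : ℕ → MvPolynomial (Fin n) ℝ} {w : Euc n}
    {Λ : ℝ[X] →ₗ[ℝ] ℝ} (hΛ : ∀ k, Λ (X ^ k) = MvPolynomial.eval w (M k))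
    (P : (MvPolynomial (Fin n) ℝ)[X]) :
    Λ (P.map (MvPolynomial.eval w)) = MvPolynomial.eval w (momentFunctional M P) := by
  induction P using Polynomial.induction_on' with
  | add p q hp hq => simp [hp, hq]
  | monomial k a =>
    rw [map_monomial, ← C_mul_X_pow_eq_monomial, ← smul_eq_C_mul, map_smul, hΛ,
      ← C_mul_X_pow_eq_monomial, ← smul_eq_C_mul, map_smul, momentFunctional_X_pow]
    simp

/-- Generic factorization of the minimal recurrence of a sequence of polynomial moments, when at
each point the recurrence has at most two roots. -/
lemma exists_generic_factorization {n : ℕ} (hn : 0 < n) {M : ℕ → MvPolynomial (Fin n) ℝ}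
    (hM0 : ∃ k, M k ≠ 0) {Λ : Euc n → ℝ[X] →ₗ[ℝ] ℝ}
    (hΛ : ∀ w k, Λ w (X ^ k) = MvPolynomial.eval w (M k)) (ρ₁ ρ₂ : Euc n → ℝ) (m : ℕ)
    (hrec : ∀ w, w ≠ 0 → ∀ P, Λ w (((X - C (ρ₁ w)) * (X - C (ρ₂ w))) ^ m * P) = 0) :
    ∃ Q : (MvPolynomial (Fin n) ℝ)[X], Q.Monic ∧ 0 < Q.natDegree ∧
      ∃ G : Set (Euc n), Dense G ∧ (∀ w ∈ G, w ≠ 0) ∧ ∀ w ∈ G, ∃ i j : ℕ,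
        Q.map (MvPolynomial.eval w) = (X - C (ρ₁ w)) ^ i * (X - C (ρ₂ w)) ^ j := by
  have : Nontrivial (Euc n) := by
    have : Nonempty (Fin n) := ⟨⟨0, hn⟩⟩
    infer_instance
  have hdense : ∀ {δ : MvPolynomial (Fin n) ℝ}, δ ≠ 0 →
      Dense ({w : Euc n | MvPolynomial.eval w δ ≠ 0} ∩ {0}ᶜ) := fun hδ =>
    (dense_eval_ne_zero hδ).inter_of_isOpen_right (dense_compl_singleton 0)
      isOpen_compl_singleton
  set L := momentFunctional M with hL
  have hmon : ∀ w, (((X - C (ρ₁ w)) * (X - C (ρ₂ w))) ^ m).Monic := fun w =>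
    ((monic_X_sub_C _).mul (monic_X_sub_C _)).pow m
  have hdeg : ∀ w, (((X - C (ρ₁ w)) * (X - C (ρ₂ w))) ^ m).natDegree = m * 2 := fun w => by
    rw [natDegree_pow, natDegree_mul (X_sub_C_ne_zero _) (X_sub_C_ne_zero _)]
    simp
  -- The `m * 2` test powers suffice: a nonzero `L (Q * P)` would be nonzero at some `w ≠ 0`, where
  -- a monic annihilator of degree `m * 2` is known. This bound does not depend on `w`.
  obtain ⟨A, hA, hAL⟩ := exists_monic_annihilator L (m * 2) (by
    intro Q hQ P
    by_contra hne
    obtain ⟨w, hw, hw0⟩ := (hdense hne).nonempty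
    apply hw
    rw [← eval_momentFunctional (hΛ w), Polynomial.map_mul]
    refine annihilates_of_forall_pow_lt (Λ w) (hmon w) (hrec w hw0) (hdeg w).le
      (fun j hj => ?_) _
    have := eval_momentFunctional (hΛ w) (Q * X ^ j)
    rw [← hL, hQ j hj] at this
    simpa using this)
  obtain ⟨Q, hQ, hQL, hQmin⟩ := exists_monic_minimal_annihilator L A hA hAL
  obtain ⟨δ, hδ, hdvd⟩ := exists_generic_dvd L hQ hQL hQmin
  refine ⟨Q, hQ, ?_, _, hdense hδ, fun w hw => hw.2, fun w hw => ?_⟩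
  · by_contra h0
    have h1 : Q = 1 := hQ.natDegree_eq_zero.1 (by omega)
    obtain ⟨k, hk⟩ := hM0
    apply hk
    rw [← momentFunctional_X_pow M k, ← hL]
    simpa [h1] using hQL (X ^ k)
  · exact eq_pow_mul_pow_of_dvd (hQ.map _) (hdvd (MvPolynomial.eval w) (Λ w)
      (eval_momentFunctional (hΛ w)) hw.1 _ (hrec w hw.2))

/-- If the sequence of moments at each `w ≠ 0` satisfies a recurrence whose roots are the extreme
values `ρ₁ w > ρ₂ w`, and the moments are polynomial in `w`, then the midpoint of the extreme
values is linear and the square of the width is a quadratic form. -/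
lemma linear_and_quadratic_of_moments {n : ℕ} (hn : 1 < n) {M : ℕ → MvPolynomial (Fin n) ℝ}
    (hM0 : ∃ k, M k ≠ 0) {Λ : Euc n → ℝ[X] →ₗ[ℝ] ℝ}
    (hΛ : ∀ w k, Λ w (X ^ k) = MvPolynomial.eval w (M k)) (ρ₁ ρ₂ : Euc n → ℝ) (m : ℕ)
    (hrec : ∀ w, w ≠ 0 → ∀ P, Λ w (((X - C (ρ₁ w)) * (X - C (ρ₂ w))) ^ m * P) = 0)
    (hc₁ : Continuous ρ₁) (hc₂ : Continuous ρ₂)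
    (hh₁ : ∀ c : ℝ, 0 < c → ∀ w, ρ₁ (c • w) = c * ρ₁ w)
    (hneg : ∀ w, ρ₂ w = -ρ₁ (-w)) (hlt : ∀ w, w ≠ 0 → ρ₂ w < ρ₁ w) :
    (∃ ℓ : Euc n →ₗ[ℝ] ℝ, ∀ w, ρ₁ w + ρ₂ w = ℓ w) ∧
      ∃ b : Euc n →ₗ[ℝ] Euc n →ₗ[ℝ] ℝ, ∀ w, (ρ₁ w - ρ₂ w) ^ 2 = b w w := by
  have hneg' : ∀ w, ρ₁ w = -ρ₂ (-w) := fun w => by rw [hneg]; simp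
  have hh₂ : ∀ c : ℝ, 0 < c → ∀ w, ρ₂ (c • w) = c * ρ₂ w := fun c hc w => by
    rw [hneg, hneg, ← smul_neg, hh₁ c hc]; ring
  obtain ⟨Q, hQ, hd0, G, hG, hG0, hfac⟩ :=
    exists_generic_factorization (by omega) hM0 hΛ ρ₁ ρ₂ m hrec
  set d := Q.natDegree with hd
  let e : Euc n → ℝ := fun w => -MvPolynomial.eval w (Q.coeff (d - 1))
  have he : ContDiff ℝ ∞ e := (contDiff_eval _).neg
  have hfac' : ∀ w ∈ G, ∃ i j : ℕ, i + j = d ∧ e w = i * ρ₁ w + j * ρ₂ w ∧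
      Q.map (MvPolynomial.eval w) = (X - C (ρ₁ w)) ^ i * (X - C (ρ₂ w)) ^ j := by
    intro w hw
    obtain ⟨i, j, hij⟩ := hfac w hw
    obtain ⟨h1, h2⟩ := coeff_pow_mul_pow (ρ₁ w) (ρ₂ w) i j
    rw [← hij] at h1 h2
    rw [hQ.natDegree_map] at h1
    refine ⟨i, j, h1.symm, ?_, hij⟩
    rw [nextCoeff_of_natDegree_pos (by rwa [hQ.natDegree_map]), hQ.natDegree_map, coeff_map] at h2
    simp only [e]
    rw [h2, neg_neg]
  -- Solving `e = i ρ₁ + j ρ₂`, `i + j = d` for `i` gives an expression that is continuous off the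
  -- origin, also where the factorization is not known.
  let α : Euc n → ℝ := fun w => (e w - d * ρ₂ w) / (ρ₁ w - ρ₂ w)
  have hα : ContinuousOn α {0}ᶜ := by
    refine ContinuousOn.div (he.continuous.sub (by fun_prop)).continuousOn (by fun_prop)
      fun w hw => ?_
    have := hlt w hw
    linarith
  have hαG : ∀ w ∈ G, ∃ i j : ℕ, i + j = d ∧ α w = i ∧
      Q.map (MvPolynomial.eval w) = (X - C (ρ₁ w)) ^ i * (X - C (ρ₂ w)) ^ j := by
    intro w hw
    obtain ⟨i, j, hij, hew, hq⟩ := hfac' w hw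
    refine ⟨i, j, hij, ?_, hq⟩
    have := hlt w (hG0 w hw)
    have hd' : (d : ℝ) = i + j := by exact_mod_cast hij.symm
    simp only [α]
    rw [div_eq_iff (by linarith), hew, hd']
    ring
  -- The values are natural numbers on the dense set `G`, and `ℕ` is closed in `ℝ`.
  have hmaps : Set.MapsTo α {0}ᶜ (Set.range ((↑) : ℕ → ℝ)) := by
    intro w hw
    rw [← Nat.isClosedEmbedding_coe_real.isClosed_range.closure_eq]
    have hw' : w ∈ closure (G ∩ {0}ᶜ) := by
      rw [Set.inter_comm]
      exact (hG.open_subset_closure_inter isOpen_compl_singleton) hw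
    refine ((hα w hw).mono Set.inter_subset_right).mem_closure hw' fun v hv => ?_
    obtain ⟨i, -, -, hi, -⟩ := hαG v hv.1
    exact ⟨i, hi.symm⟩
  -- Here `1 < n` enters: the complement of the origin is connected, so the multiplicity is
  -- constant.
  obtain ⟨-, ⟨a, rfl⟩, ha⟩ :=
    (isConnected_compl_singleton_of_one_lt_rank (by rw [← Module.finrank_eq_rank]; simpa using hn)
      (0 : Euc n)).isPreconnected.eqOn_const_of_mapsTo
      Nat.isClosedEmbedding_coe_real.isEmbedding.isDiscrete_range hα hmaps (Set.range_nonempty _)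
  have he_eq : e = fun w => a * ρ₁ w + (d - a) * ρ₂ w := by
    refine Continuous.ext_on hG he.continuous (by fun_prop) fun w hw => ?_
    have h1 : α w = a := ha (hG0 w hw)
    have := hlt w (hG0 w hw)
    simp only [α] at h1
    rw [div_eq_iff (by linarith)] at h1
    linarith
  have he_lin := eq_fderiv_of_homogeneous (he.differentiable (by simp) 0) (fun c hc w => by
    rw [he_eq, smul_eq_mul]; simp only [hh₁ c hc, hh₂ c hc]; ring)
  -- The form `e` is odd, while `w ↦ -w` turns `a ρ₁ + (d - a) ρ₂` into `-(a ρ₂ + (d - a) ρ₁)`; as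
  -- `ρ₁ ≠ ρ₂`, the multiplicities agree.
  have had : (d : ℝ) = 2 * a := by
    obtain ⟨w, hw⟩ := hG.nonempty
    have h1 := he_lin (-w)
    rw [map_neg, ← he_lin w, he_eq] at h1
    simp only at h1
    rw [hneg' w, hneg w] at h1
    have h2 := hlt w (hG0 w hw)
    rw [hneg' w, hneg w] at h2
    have h3 : (d - 2 * a : ℝ) * (ρ₁ (-w) - ρ₂ (-w)) = 0 := by linarith
    rcases mul_eq_zero.1 h3 with h | h <;> linarith
  have had' : d = 2 * a := by exact_mod_cast had
  obtain ⟨a, rfl⟩ : ∃ a', a = a' + 1 := ⟨a - 1, by omega⟩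
  have hapos : (0 : ℝ) < (a : ℝ) + 1 := by positivity
  have hs : ∀ w, ρ₁ w + ρ₂ w = e w / (a + 1) := by
    intro w
    rw [he_eq, eq_div_iff hapos.ne', had]
    push_cast
    ring
  refine ⟨⟨((1 : ℝ) / (a + 1)) • (fderiv ℝ e 0 : Euc n →ₗ[ℝ] ℝ), fun w => ?_⟩, ?_⟩
  · rw [hs, he_lin w]
    simp
    ring
  · refine exists_bilin_of_homogeneous ?_ fun c hc w => by rw [hh₁ c hc, hh₂ c hc]; ring
    -- With `s = ρ₁ + ρ₂`, write `(ρ₁ - ρ₂) ^ 2 = s ^ 2 - 4 ρ₁ ρ₂` and take `ρ₁ ρ₂` from the third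
    -- coefficient of `((X - ρ₁) (X - ρ₂)) ^ (a + 1)`. Density of `G` extends the identity to all
    -- `w`.
    have hq : (fun w => (ρ₁ w - ρ₂ w) ^ 2) = fun w => (2 * a + 1) * (e w / (a + 1)) ^ 2 -
        4 / (a + 1) * MvPolynomial.eval w (Q.coeff (2 * a)) := by
      refine Continuous.ext_on hG (by fun_prop)
        (((he.continuous.div_const _).pow 2).const_mul _ |>.sub
          ((contDiff_eval _).continuous.const_mul _)) fun w hw => ?_
      obtain ⟨i, j, hij, hi, hq⟩ := hαG w hw
      have hia : i = a + 1 := by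
        have : α w = (a + 1 : ℕ) := ha (hG0 w hw)
        rw [hi] at this
        exact_mod_cast this
      have hja : j = a + 1 := by omega
      rw [hia, hja, ← mul_pow] at hq
      have h := (coeff_pow_quadratic (ρ₁ w) (ρ₂ w) a).2.2
      rw [← hq, coeff_map] at h
      simp only
      rw [h, ← hs]
      field_simp
      ring
    rw [hq]
    exact (((((he.of_le (by norm_cast)).div_const _).pow 2).const_smul
      (2 * a + 1 : ℝ)).sub (((contDiff_eval _).of_le (by norm_cast)).const_smul
      (4 / (a + 1) : ℝ)))

end RadonSupport

/-! ### Support functions and ellipsoids. -/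

namespace RadonSupport

/-- The support function of a set. -/
noncomputable def supportFn {n : ℕ} (D : Set (Euc n)) (w : Euc n) : ℝ :=
  sSup ((fun x => inner ℝ x w) '' D)

section supportFn

variable {n : ℕ} {D : Set (Euc n)}

lemma bddAbove_inner_image (hb : Bornology.IsBounded D) (w : Euc n) :
    BddAbove ((fun x => inner ℝ x w) '' D) := by
  obtain ⟨R, hR⟩ := hb.exists_norm_le
  refine ⟨R * ‖w‖, ?_⟩
  rintro _ ⟨x, hx, rfl⟩
  exact (real_inner_le_norm x w).trans (mul_le_mul_of_nonneg_right (hR x hx) (norm_nonneg w))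

lemma inner_le_supportFn (hb : Bornology.IsBounded D) (w : Euc n) {x : Euc n} (hx : x ∈ D) :
    inner ℝ x w ≤ supportFn D w :=
  le_csSup (bddAbove_inner_image hb w) ⟨x, hx, rfl⟩

lemma inner_le_supportFn_of_mem_closure (hb : Bornology.IsBounded D) (w : Euc n) {x : Euc n}
    (hx : x ∈ closure D) : inner ℝ x w ≤ supportFn D w := by
  have hc : IsClosed {x : Euc n | inner ℝ x w ≤ supportFn D w} :=
    isClosed_le (by fun_prop) continuous_const
  exact closure_minimal (fun y hy => inner_le_supportFn hb w hy) hc hx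

lemma supportFn_le (hne : D.Nonempty) {w : Euc n} {p : ℝ} (h : ∀ x ∈ D, inner ℝ x w ≤ p) :
    supportFn D w ≤ p := by
  refine csSup_le (hne.image _) ?_
  rintro _ ⟨x, hx, rfl⟩
  exact h x hx

lemma supportFn_smul (hb : Bornology.IsBounded D) (hne : D.Nonempty) (c : ℝ) (hc : 0 < c)
    (w : Euc n) : supportFn D (c • w) = c * supportFn D w := by
  refine le_antisymm (supportFn_le hne fun x hx => ?_) ?_
  · rw [inner_smul_right]
    exact mul_le_mul_of_nonneg_left (inner_le_supportFn hb w hx) hc.le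
  · rw [← le_div_iff₀' hc]
    refine supportFn_le hne fun x hx => ?_
    rw [le_div_iff₀' hc, ← inner_smul_right (𝕜 := ℝ)]
    exact inner_le_supportFn hb _ hx

lemma continuous_supportFn (hb : Bornology.IsBounded D) (hne : D.Nonempty) :
    Continuous (supportFn D) := by
  obtain ⟨R, hR0, hR⟩ := hb.exists_pos_norm_le
  refine (LipschitzWith.of_le_add_mul ⟨R, hR0.le⟩ fun v w => ?_).continuous
  refine supportFn_le hne fun x hx => ?_
  have h1 : inner ℝ x v = inner ℝ x w + inner ℝ x (v - w) := by rw [inner_sub_right]; ring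
  rw [h1, dist_eq_norm]
  exact add_le_add (inner_le_supportFn hb w hx)
    ((real_inner_le_norm _ _).trans (mul_le_mul_of_nonneg_right (hR x hx) (norm_nonneg _)))

/-- A point of an open set can be moved slightly along `w`, so the width is positive. -/
lemma neg_supportFn_neg_lt (ho : IsOpen D) (hb : Bornology.IsBounded D) (hne : D.Nonempty)
    {w : Euc n} (hw : w ≠ 0) : -supportFn D (-w) < supportFn D w := by
  obtain ⟨x, hx⟩ := hne
  have hcont : Continuous fun t : ℝ => x + t • w := by fun_prop
  have hev : ∀ᶠ t in 𝓝 (0 : ℝ), x + t • w ∈ D :=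
    hcont.continuousAt.eventually_mem (ho.mem_nhds (by simpa using hx))
  obtain ⟨t, ht, ht0⟩ := ((hev.filter_mono nhdsWithin_le_nhds).and
    (self_mem_nhdsWithin (s := Set.Ioi (0 : ℝ)))).exists
  have h1 := inner_le_supportFn hb w ht
  have h2 := inner_le_supportFn hb (-w) hx
  rw [inner_neg_right] at h2
  rw [inner_add_left, real_inner_smul_left] at h1
  have h3 : 0 < inner ℝ w w := real_inner_self_pos.2 hw
  have h4 : 0 < t * inner ℝ w w := mul_pos ht0 h3
  linarith

lemma eq_of_mem_supportingPlanes (hb : Bornology.IsBounded D) {ξ : Sph n} {p : ℝ}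
    (h : (ξ, p) ∈ supportingPlanes D) :
    p = supportFn D ξ ∨ p = -supportFn D (-ξ) := by
  obtain ⟨⟨x, hx, hxp⟩, h⟩ := h
  simp only at hxp h
  have hne : D.Nonempty := closure_nonempty_iff.1 ⟨x, hx⟩
  rcases h with h | h
  · left
    refine le_antisymm ?_ (supportFn_le hne h)
    rw [← hxp]
    exact inner_le_supportFn_of_mem_closure hb _ hx
  · right
    have h1 := inner_le_supportFn_of_mem_closure hb (-(ξ : Euc n)) hx
    have h2 : supportFn D (-(ξ : Euc n)) ≤ -p := supportFn_le hne fun y hy => by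
      rw [inner_neg_right]; exact neg_le_neg (h y hy)
    rw [inner_neg_right, hxp] at h1
    linarith

/-- Hahn–Banach separation of a point from the closed convex set `closure D`. -/
lemma mem_closure_iff_forall_inner_le (hconv : Convex ℝ D) (hb : Bornology.IsBounded D)
    (hne : D.Nonempty) {x : Euc n} :
    x ∈ closure D ↔ ∀ w, inner ℝ x w ≤ supportFn D w := by
  refine ⟨fun hx w => inner_le_supportFn_of_mem_closure hb w hx, fun h => ?_⟩
  by_contra hx
  obtain ⟨f, u, hf, hu⟩ := geometric_hahn_banach_closed_point hconv.closure isClosed_closure hx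
  have hfw : ∀ y, f y = inner ℝ y ((InnerProductSpace.toDual ℝ (Euc n)).symm f) := fun y => by
    rw [real_inner_comm, InnerProductSpace.toDual_symm_apply]
  have h1 := h ((InnerProductSpace.toDual ℝ (Euc n)).symm f)
  have h2 : supportFn D ((InnerProductSpace.toDual ℝ (Euc n)).symm f) ≤ u :=
    supportFn_le hne fun y hy => by rw [← hfw]; exact (hf y (subset_closure hy)).le
  rw [← hfw] at h1
  linarith

end supportFn

open scoped MatrixOrder Matrix.Norms.L2Operator in
/-- A nonnegative quadratic form on `ℝⁿ` is `‖C w‖ ^ 2` for some linear map `C`. -/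
lemma exists_linearMap_norm_sq_eq {n : ℕ} (b : Euc n →ₗ[ℝ] Euc n →ₗ[ℝ] ℝ)
    (hb : ∀ w, 0 ≤ b w w) : ∃ T : Euc n →ₗ[ℝ] Euc n, ∀ w, ‖T w‖ ^ 2 = b w w := by
  let e : Fin n → Euc n := fun i => EuclideanSpace.single i 1
  -- The form `b` need not be symmetric; symmetrizing does not change `b w w`.
  let B : Matrix (Fin n) (Fin n) ℝ := Matrix.of fun i j => (b (e i) (e j) + b (e j) (e i)) / 2
  have hexp : ∀ w : Euc n, b w w = ∑ i, ∑ j, w i * w j * b (e i) (e j) := by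
    intro w
    have hw : w = ∑ i, w i • e i := by
      simpa [e] using ((EuclideanSpace.basisFun (Fin n) ℝ).sum_repr w).symm
    conv_lhs => rw [hw]
    simp only [map_sum, LinearMap.sum_apply, map_smul, LinearMap.smul_apply, smul_eq_mul]
    simp only [Finset.mul_sum]
    rw [Finset.sum_comm]
    refine Finset.sum_congr rfl fun i _ => Finset.sum_congr rfl fun j _ => ?_
    ring
  have hB : ∀ w : Euc n, (w : Fin n → ℝ) ⬝ᵥ (B.mulVec w) = b w w := by
    intro w
    have h1 : (w : Fin n → ℝ) ⬝ᵥ (B.mulVec w) =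
        ((∑ i, ∑ j, w i * w j * b (e i) (e j)) + ∑ i, ∑ j, w i * w j * b (e j) (e i)) / 2 := by
      simp only [dotProduct, Matrix.mulVec, B, Matrix.of_apply, Finset.mul_sum]
      rw [← Finset.sum_add_distrib, Finset.sum_div]
      refine Finset.sum_congr rfl fun i _ => ?_
      rw [← Finset.sum_add_distrib, Finset.sum_div]
      refine Finset.sum_congr rfl fun j _ => ?_
      ring
    have h2 : ∑ i, ∑ j, w i * w j * b (e j) (e i) = b w w := by
      rw [hexp, Finset.sum_comm]
      refine Finset.sum_congr rfl fun i _ => Finset.sum_congr rfl fun j _ => ?_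
      ring
    rw [h1, h2, ← hexp]
    ring
  have hpsd : B.PosSemidef := by
    refine Matrix.PosSemidef.of_dotProduct_mulVec_nonneg ?_ fun w => ?_
    · ext i j
      simp [B, add_comm]
    · have := hB (WithLp.toLp 2 w)
      simp only at this
      rw [star_trivial, this]
      exact hb _
  obtain ⟨T, hT⟩ := CStarAlgebra.nonneg_iff_eq_star_mul_self.1 hpsd.nonneg
  refine ⟨Matrix.toEuclideanLin T, fun w => ?_⟩
  rw [← hB, hT, EuclideanSpace.norm_sq_eq, ← Matrix.mulVec_mulVec, Matrix.dotProduct_mulVec,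
    Matrix.star_eq_conjTranspose, Matrix.conjTranspose_eq_transpose_of_trivial,
    Matrix.vecMul_transpose]
  simp [dotProduct, Matrix.toLpLin_apply, pow_two]

/-- A bounded open convex set is bounded by an ellipsoid as soon as the midpoint of its extreme
values in each direction is linear and the square of its width is a quadratic form. -/
lemma isEllipsoid_frontier {n : ℕ} {D : Set (Euc n)} (ho : IsOpen D) (hconv : Convex ℝ D)
    (hb : Bornology.IsBounded D) (hne : D.Nonempty)
    (hℓ : ∃ ℓ : Euc n →ₗ[ℝ] ℝ, ∀ w, supportFn D w + -supportFn D (-w) = ℓ w)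
    (hq : ∃ b : Euc n →ₗ[ℝ] Euc n →ₗ[ℝ] ℝ,
      ∀ w, (supportFn D w - -supportFn D (-w)) ^ 2 = b w w) :
    IsEllipsoid (frontier D) := by
  obtain ⟨ℓ, hℓ⟩ := hℓ
  obtain ⟨b, hq⟩ := hq
  obtain ⟨S, hS⟩ := exists_linearMap_norm_sq_eq b fun w => by rw [← hq]; positivity
  have h0 : supportFn D 0 = 0 := by
    have := supportFn_smul hb hne 2 two_pos 0
    rw [smul_zero] at this
    linarith
  have hwidth : ∀ w, supportFn D w - -supportFn D (-w) = ‖S w‖ := by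
    intro w
    refine (pow_left_inj₀ ?_ (norm_nonneg _) two_ne_zero).1 (by rw [hq, hS])
    by_cases hw : w = 0
    · simp [hw, h0]
    · exact sub_nonneg.2 (neg_supportFn_neg_lt ho hb hne hw).le
  have hSinj : Function.Injective S := by
    rw [← LinearMap.ker_eq_bot, LinearMap.ker_eq_bot']
    intro w hw
    by_contra hne'
    have h1 := neg_supportFn_neg_lt ho hb hne hne'
    have h2 := hwidth w
    rw [hw, norm_zero] at h2
    linarith
  have hSsurj : Function.Surjective S := LinearMap.injective_iff_surjective.1 hSinj
  let c : Euc n := (InnerProductSpace.toDual ℝ (Euc n)).symm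
    (LinearMap.toContinuousLinearMap ((1 / 2 : ℝ) • ℓ))
  have hc : ∀ w, inner ℝ c w = 1 / 2 * ℓ w := by
    intro w
    rw [InnerProductSpace.toDual_symm_apply]
    rfl
  have hsupp : ∀ w, supportFn D w = inner ℝ c w + 1 / 2 * ‖S w‖ := by
    intro w
    rw [hc, ← hℓ, ← hwidth]
    ring
  -- The support function of the image of the unit ball under `A` is `‖A* w‖`, so `‖S w‖ / 2` calls
  -- for half the adjoint of `S`.
  let A : Euc n →ₗ[ℝ] Euc n := (1 / 2 : ℝ) • LinearMap.adjoint S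
  have hA : ∀ y w, inner ℝ (A y) w = 1 / 2 * inner ℝ y (S w) := by
    intro y w
    simp only [A, LinearMap.smul_apply, real_inner_smul_left, LinearMap.adjoint_inner_left]
  have hAinj : Function.Injective A := by
    rw [← LinearMap.ker_eq_bot, LinearMap.ker_eq_bot']
    intro y hy
    obtain ⟨w, hw⟩ := hSsurj y
    have := hA y w
    rw [hy, inner_zero_left, hw] at this
    exact inner_self_eq_zero.1 (by linarith : inner ℝ y y = 0)
  let Ae : Euc n ≃ₗ[ℝ] Euc n := LinearEquiv.ofInjectiveEndo A hAinj
  let Φ : Euc n ≃ᵃ[ℝ] Euc n := Ae.toAffineEquiv.trans (AffineEquiv.constVAdd ℝ (Euc n) c)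
  have hΦ : ∀ y, Φ y = c + A y := fun y => rfl
  have hcl : closure D = Φ '' Metric.closedBall 0 1 := by
    ext x
    obtain ⟨y, rfl⟩ := Φ.surjective x
    rw [Φ.injective.mem_set_image, mem_closedBall_zero_iff,
      mem_closure_iff_forall_inner_le hconv hb hne]
    simp only [hΦ, hsupp, inner_add_left, hA]
    constructor
    · intro h
      -- Testing at `w` with `S w = y` gives `‖y‖ ^ 2 ≤ ‖y‖`.
      obtain ⟨w, hw⟩ := hSsurj y
      have h1 := h w
      rw [hw, real_inner_self_eq_norm_sq] at h1
      by_contra hlt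
      nlinarith
    · intro hy w
      have h1 := real_inner_le_norm y (S w)
      nlinarith [norm_nonneg (S w)]
  refine ⟨Φ, ?_⟩
  -- An open convex set is the interior of its closure.
  have hfr : frontier D = frontier (closure D) := by
    rw [frontier, frontier, closure_closure,
      hconv.interior_closure_eq_interior_of_nonempty_interior (by rwa [ho.interior_eq])]
  rw [hfr, hcl, ← frontier_closedBall (0 : Euc n) one_ne_zero]
  exact (Φ.toContinuousAffineEquiv.toHomeomorph.image_frontier _).symm

end RadonSupport

/-! ### Jets and functionals of finite order. -/

namespace RadonSupport

/-- The algebra of smooth real functions on `E`. -/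
def SmoothFn (E : Type*) [NormedAddCommGroup E] [NormedSpace ℝ E] : Subalgebra ℝ (E → ℝ) where
  carrier := {u | ContDiff ℝ ∞ u}
  mul_mem' {u v} (hu : ContDiff ℝ ∞ u) (hv : ContDiff ℝ ∞ v) := hu.mul hv
  add_mem' {u v} (hu : ContDiff ℝ ∞ u) (hv : ContDiff ℝ ∞ v) := hu.add hv
  algebraMap_mem' c := (contDiff_const : ContDiff ℝ ∞ fun _ : E => c)

section SmoothFn

variable {E : Type*} [NormedAddCommGroup E] [NormedSpace ℝ E]

lemma SmoothFn.contDiff (u : SmoothFn E) : ContDiff ℝ ∞ (u : E → ℝ) := u.2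

lemma SmoothFn.contDiff_nat (u : SmoothFn E) (i : ℕ) : ContDiff ℝ i (u : E → ℝ) :=
  (SmoothFn.contDiff u).of_le (by exact_mod_cast le_top)

lemma SmoothFn.continuous_iteratedFDeriv (u : SmoothFn E) (i : ℕ) :
    Continuous (iteratedFDeriv ℝ i (u : E → ℝ)) :=
  (SmoothFn.contDiff u).continuous_iteratedFDeriv (by exact_mod_cast le_top)

/-- The space of (formal) jets of order `N` of functions on `K`. -/
def JetSpace (K : Set E) (N : ℕ) : Type _ :=
  (i : Fin (N + 1)) → C(K, E [×(i : ℕ)]→L[ℝ] ℝ)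

noncomputable instance (K : Set E) (N : ℕ) [CompactSpace K] : NormedAddCommGroup (JetSpace K N) :=
  inferInstanceAs (NormedAddCommGroup ((i : Fin (N + 1)) → C(K, E [×(i : ℕ)]→L[ℝ] ℝ)))

noncomputable instance (K : Set E) (N : ℕ) [CompactSpace K] : NormedSpace ℝ (JetSpace K N) :=
  inferInstanceAs (NormedSpace ℝ ((i : Fin (N + 1)) → C(K, E [×(i : ℕ)]→L[ℝ] ℝ)))

instance (K : Set E) (N : ℕ) [CompactSpace K] : CompleteSpace (JetSpace K N) :=
  inferInstanceAs (CompleteSpace ((i : Fin (N + 1)) → C(K, E [×(i : ℕ)]→L[ℝ] ℝ)))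

/-- The restriction to `K` of the derivatives of order at most `N` of a smooth function. -/
noncomputable def jet (K : Set E) (N : ℕ) [CompactSpace K] : SmoothFn E →ₗ[ℝ] JetSpace K N where
  toFun u := fun i => ⟨fun x => iteratedFDeriv ℝ i (u : E → ℝ) x,
    (SmoothFn.continuous_iteratedFDeriv u i).comp continuous_subtype_val⟩
  map_add' u v := by
    refine funext fun i => ContinuousMap.ext fun x => ?_
    exact iteratedFDeriv_add_apply (SmoothFn.contDiff_nat u i).contDiffAt
      (SmoothFn.contDiff_nat v i).contDiffAt
  map_smul' c u := by
    refine funext fun i => ContinuousMap.ext fun x => ?_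
    exact iteratedFDeriv_const_smul_apply (SmoothFn.contDiff_nat u i).contDiffAt

/-- A component of a jet. -/
def JetSpace.component {K : Set E} {N : ℕ} (j : JetSpace K N) (i : Fin (N + 1)) :
    C(K, E [×(i : ℕ)]→L[ℝ] ℝ) := j i

lemma JetSpace.norm_component_le {K : Set E} {N : ℕ} [CompactSpace K] (j : JetSpace K N)
    (i : Fin (N + 1)) : ‖j.component i‖ ≤ ‖j‖ :=
  norm_le_pi_norm (G := fun i : Fin (N + 1) => C(K, E [×(i : ℕ)]→L[ℝ] ℝ)) j i

/-- Evaluation of a component of a jet at a point, as a linear map. -/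
noncomputable def JetSpace.evalLM {K : Set E} {N : ℕ} [CompactSpace K] (i : Fin (N + 1)) (x : K) :
    JetSpace K N →ₗ[ℝ] (E [×(i : ℕ)]→L[ℝ] ℝ) where
  toFun j := j.component i x
  map_add' _ _ := rfl
  map_smul' _ _ := rfl

/-- Evaluation of a component of a jet at a point, as a continuous linear map. -/
noncomputable def JetSpace.evalL {K : Set E} {N : ℕ} [CompactSpace K] (i : Fin (N + 1)) (x : K) :
    JetSpace K N →L[ℝ] (E [×(i : ℕ)]→L[ℝ] ℝ) :=
  (JetSpace.evalLM i x).mkContinuous 1 fun j => by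
    rw [one_mul]
    exact ((j.component i).norm_coe_le_norm x).trans (j.norm_component_le i)

lemma JetSpace.evalL_jet {K : Set E} {N : ℕ} [CompactSpace K] (i : Fin (N + 1)) (x : K)
    (u : SmoothFn E) : JetSpace.evalL i x (jet K N u) = iteratedFDeriv ℝ i (u : E → ℝ) x := rfl

lemma JetSpace.ext_evalL {K : Set E} {N : ℕ} [CompactSpace K] {j j' : JetSpace K N}
    (h : ∀ i x, JetSpace.evalL i x j = JetSpace.evalL i x j') : j = j' :=
  funext fun i => ContinuousMap.ext fun x => h i x

lemma JetSpace.norm_le {K : Set E} {N : ℕ} [CompactSpace K] {j : JetSpace K N} {B : ℝ}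
    (hB : 0 ≤ B) (h : ∀ i x, ‖JetSpace.evalL i x j‖ ≤ B) : ‖j‖ ≤ B :=
  (pi_norm_le_iff_of_nonneg (ι := Fin (N + 1))
    (G := fun i => C(K, E [×(i : ℕ)]→L[ℝ] ℝ)) hB).2 fun i =>
    (ContinuousMap.norm_le _ hB).2 fun x => h i x

lemma JetSpace.norm_evalL_le {K : Set E} {N : ℕ} [CompactSpace K] (i : Fin (N + 1)) (x : K)
    (j : JetSpace K N) : ‖JetSpace.evalL i x j‖ ≤ ‖j‖ :=
  ((j.component i).norm_coe_le_norm x).trans (j.norm_component_le i)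

/-- Joint continuity in the parameter and the point gives continuity into the compact-open topology,
by currying. -/
lemma JetSpace.continuous_of_eval {K : Set E} {N : ℕ} [CompactSpace K] {Y : Type*}
    [TopologicalSpace Y] {j : Y → JetSpace K N}
    (h : ∀ i, Continuous fun p : Y × K => JetSpace.evalL i p.2 (j p.1)) : Continuous j := by
  refine continuous_pi (A := fun i : Fin (N + 1) => C(K, E [×(i : ℕ)]→L[ℝ] ℝ)) fun i => ?_
  exact (ContinuousMap.curry ⟨_, h i⟩).continuous

/-- A functional on smooth functions has order at most `N` on the compact set `K` if it is given
by a continuous functional of the `N`-jet on `K`. -/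
def HasOrderOn (K : Set E) (N : ℕ) [CompactSpace K] (T : SmoothFn E →ₗ[ℝ] ℝ) : Prop :=
  ∃ φ : JetSpace K N →L[ℝ] ℝ, ∀ u, T u = φ (jet K N u)

/-- Factorization of a bounded functional through a linear map into a normed space. -/
lemma exists_factorization {V B : Type*} [AddCommGroup V] [Module ℝ V] [NormedAddCommGroup B]
    [NormedSpace ℝ B] (J : V →ₗ[ℝ] B) (ψ : V →ₗ[ℝ] ℝ) (c : ℝ) (h : ∀ v, |ψ v| ≤ c * ‖J v‖) :
    ∃ φ : B →L[ℝ] ℝ, ∀ v, ψ v = φ (J v) := by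
  have hker : LinearMap.ker J ≤ LinearMap.ker ψ := by
    intro v hv
    have := h v
    rw [LinearMap.mem_ker.1 hv, norm_zero, mul_zero] at this
    exact abs_nonpos_iff.1 this
  let ψ₀ : LinearMap.range J →ₗ[ℝ] ℝ :=
    ((LinearMap.ker J).liftQ ψ hker).comp J.quotKerEquivRange.symm.toLinearMap
  have hψ₀ : ∀ v, ψ₀ (J.rangeRestrict v) = ψ v := by
    intro v
    have : J.quotKerEquivRange.symm (J.rangeRestrict v) = (LinearMap.ker J).mkQ v := by
      rw [LinearEquiv.symm_apply_eq]
      rfl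
    simp only [ψ₀, LinearMap.comp_apply, LinearEquiv.coe_coe, this]
    rfl
  let ψ₁ : StrongDual ℝ (LinearMap.range J) := ψ₀.mkContinuous c (by
    rintro ⟨_, v, rfl⟩
    have := h v
    rw [← hψ₀] at this
    exact this)
  obtain ⟨φ, hφ, -⟩ := exists_extension_norm_eq (LinearMap.range J) ψ₁
  exact ⟨φ, fun v => by rw [← hψ₀]; exact (hφ (J.rangeRestrict v)).symm⟩

lemma norm_jet_le {K : Set E} {N : ℕ} [CompactSpace K] {u : SmoothFn E} {B : ℝ} (hB : 0 ≤ B)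
    (h : ∀ i ≤ N, ∀ x ∈ K, ‖iteratedFDeriv ℝ i (u : E → ℝ) x‖ ≤ B) : ‖jet K N u‖ ≤ B :=
  JetSpace.norm_le hB fun i x => h i (Nat.lt_succ_iff.1 i.2) x x.2

lemma norm_iteratedFDeriv_le_norm_jet {K : Set E} {N : ℕ} [CompactSpace K] (u : SmoothFn E)
    {i : ℕ} (hi : i ≤ N) {x : E} (hx : x ∈ K) :
    ‖iteratedFDeriv ℝ i (u : E → ℝ) x‖ ≤ ‖jet K N u‖ := by
  have h := JetSpace.norm_evalL_le ⟨i, Nat.lt_succ_iff.2 hi⟩ ⟨x, hx⟩ (jet K N u)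
  rwa [JetSpace.evalL_jet] at h

lemma HasOrderOn.exists_bound {K : Set E} {N : ℕ} [CompactSpace K] {T : SmoothFn E →ₗ[ℝ] ℝ}
    (hT : HasOrderOn K N T) : ∃ c : ℝ, 0 ≤ c ∧ ∀ u : SmoothFn E, ∀ B : ℝ, 0 ≤ B →
      (∀ i ≤ N, ∀ x ∈ K, ‖iteratedFDeriv ℝ i (u : E → ℝ) x‖ ≤ B) → |T u| ≤ c * B := by
  obtain ⟨φ, hφ⟩ := hT
  refine ⟨‖φ‖, norm_nonneg _, fun u B hB h => ?_⟩
  rw [hφ, ← Real.norm_eq_abs]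
  exact φ.le_opNorm_of_le (norm_jet_le hB h)

lemma HasOrderOn.congr {K : Set E} {N : ℕ} [CompactSpace K] {T : SmoothFn E →ₗ[ℝ] ℝ}
    (hT : HasOrderOn K N T) {u v : SmoothFn E} (h : ∀ x ∈ K, (u : E → ℝ) =ᶠ[𝓝 x] v) :
    T u = T v := by
  obtain ⟨φ, hφ⟩ := hT
  rw [hφ, hφ]
  congr 1
  refine JetSpace.ext_evalL fun i x => ?_
  exact ((h x x.2).iteratedFDeriv ℝ i).eq_of_nhds

/-- Leibniz rule; the binomial coefficients of order `i` add up to `2 ^ i`. -/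
lemma norm_iteratedFDeriv_mul_le_of_le (u v : SmoothFn E) {N : ℕ} {x : E} {A B : ℝ} (hA : 0 ≤ A)
    (hu : ∀ i ≤ N, ‖iteratedFDeriv ℝ i (u : E → ℝ) x‖ ≤ A)
    (hv : ∀ i ≤ N, ‖iteratedFDeriv ℝ i (v : E → ℝ) x‖ ≤ B) {i : ℕ} (hi : i ≤ N) :
    ‖iteratedFDeriv ℝ i ((u * v : SmoothFn E) : E → ℝ) x‖ ≤ 2 ^ N * (A * B) := by
  have hB : 0 ≤ B := (norm_nonneg _).trans (hv 0 (Nat.zero_le _))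
  calc ‖iteratedFDeriv ℝ i ((u * v : SmoothFn E) : E → ℝ) x‖
      ≤ ∑ j ∈ Finset.range (i + 1), (i.choose j : ℝ) * ‖iteratedFDeriv ℝ j (u : E → ℝ) x‖ *
          ‖iteratedFDeriv ℝ (i - j) (v : E → ℝ) x‖ :=
        norm_iteratedFDeriv_mul_le (SmoothFn.contDiff_nat u i) (SmoothFn.contDiff_nat v i) x le_rfl
    _ ≤ ∑ j ∈ Finset.range (i + 1), (i.choose j : ℝ) * (A * B) := by
        refine Finset.sum_le_sum fun j hj => ?_
        rw [mul_assoc]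
        have hj := Finset.mem_range.1 hj
        exact mul_le_mul_of_nonneg_left (mul_le_mul (hu j (by omega)) (hv (i - j) (by omega))
          (norm_nonneg _) hA) (Nat.cast_nonneg _)
    _ = 2 ^ i * (A * B) := by
        rw [← Finset.sum_mul, ← Nat.cast_sum, Nat.sum_range_choose]
        push_cast
        rfl
    _ ≤ 2 ^ N * (A * B) := by
        refine mul_le_mul_of_nonneg_right ?_ (mul_nonneg hA hB)
        exact pow_le_pow_right₀ one_le_two hi

end SmoothFn

/-- Multiplication of smooth functions by a fixed test function. -/
noncomputable def mulTest {n : ℕ} (χ : 𝓓((⊤ : Opens (Euc n)), ℝ)) :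
    SmoothFn (Euc n) →ₗ[ℝ] 𝓓((⊤ : Opens (Euc n)), ℝ) where
  toFun u := ⟨fun x => χ x * (u : Euc n → ℝ) x, χ.contDiff.mul (SmoothFn.contDiff u),
    χ.hasCompactSupport.mul_right, fun _ _ => trivial⟩
  map_add' u v := by
    ext x
    exact mul_add _ _ _
  map_smul' c u := by
    ext x
    exact mul_left_comm _ _ _

/-- A distribution cut off by a test function has finite order. -/
lemma exists_hasOrderOn {n : ℕ} (f : 𝓓((⊤ : Opens (Euc n)), ℝ) →L[ℝ] ℝ)
    (χ : 𝓓((⊤ : Opens (Euc n)), ℝ)) [CompactSpace (tsupport χ)] :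
    ∃ N : ℕ, HasOrderOn (tsupport χ) N (f.toLinearMap.comp (mulTest χ)) := by
  let K : Compacts (Euc n) := ⟨tsupport χ, χ.hasCompactSupport⟩
  have hKtop : (K : Set (Euc n)) ⊆ (⊤ : Opens (Euc n)) := fun _ _ => trivial
  let f' : 𝓓_{K}(Euc n, ℝ) →L[ℝ] ℝ := f.comp (TestFunction.ofSupportedInCLM ℝ hKtop)
  obtain ⟨s, c, -, hc⟩ := Seminorm.bound_of_continuous
    (ContDiffMapSupportedIn.withSeminorms ℝ (Euc n) ℝ ⊤ K)
    ((normSeminorm ℝ ℝ).comp f'.toLinearMap) (continuous_norm.comp f'.continuous)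
  let χ' : SmoothFn (Euc n) := ⟨χ, χ.contDiff⟩
  -- Continuity on the functions supported in the compact set bounds `f'` by finitely many
  -- seminorms; the order is the largest index among them.
  set N := s.sup id with hN
  set M := ‖jet (tsupport χ) N χ'‖ with hM
  refine ⟨N, exists_factorization _ _ (c * (2 ^ N * M)) fun u => ?_⟩
  let v : 𝓓_{K}(Euc n, ℝ) := ContDiffMapSupportedIn.of_support_subset (f := fun x => χ x * u.1 x)
    (χ.contDiff.mul (SmoothFn.contDiff u))
    (fun x hx => subset_tsupport _ (left_ne_zero_of_mul hx))
  have hv : f (mulTest χ u) = f' v := rfl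
  have h1 : |f' v| ≤ c * (s.sup (ContDiffMapSupportedIn.seminorm ℝ (Euc n) ℝ ⊤ K)) v := hc v
  refine (hv ▸ h1 : |f (mulTest χ u)| ≤ _).trans ?_
  rw [mul_assoc]
  refine mul_le_mul_of_nonneg_left ?_ c.2
  have hnn : 0 ≤ 2 ^ N * M * ‖jet (tsupport χ) N u‖ := by positivity
  refine Seminorm.finset_sup_apply_le hnn fun i hi => ?_
  rw [ContDiffMapSupportedIn.seminorm_top_le_iff ℝ hnn]
  intro x hx
  have hiN : i ≤ N := Finset.le_sup (f := id) hi
  rw [mul_assoc]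
  exact norm_iteratedFDeriv_mul_le_of_le χ' u (norm_nonneg _)
    (fun j hj => norm_iteratedFDeriv_le_norm_jet χ' hj hx)
    (fun j hj => norm_iteratedFDeriv_le_norm_jet u hj hx) hiN

end RadonSupport

/-! ### Ridge functions and their superpositions. -/

namespace RadonSupport

/-- Differentiation under the integral sign, with the derivative identified by its values. -/
lemma hasFDerivAt_integral_of_apply {E H Y : Type*} [NormedAddCommGroup E] [NormedSpace ℝ E]
    [NormedAddCommGroup H] [NormedSpace ℝ H] [CompleteSpace H] [MeasurableSpace Y]
    {μ : Measure Y} {F : E → Y → H} {F' : E → Y → E →L[ℝ] H} {bound : Y → ℝ} {x₀ : E}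
    {L : E →L[ℝ] H}
    (hF : ∀ x, Integrable (F x) μ) (hF' : AEStronglyMeasurable (F' x₀) μ)
    (hb : Integrable bound μ) (hle : ∀ x y, ‖F' x y‖ ≤ bound y)
    (hd : ∀ x y, HasFDerivAt (fun x => F x y) (F' x y) x)
    (hL : ∀ v, Integrable (fun y => F' x₀ y v) μ → L v = ∫ y, F' x₀ y v ∂μ) :
    HasFDerivAt (fun x => ∫ y, F x y ∂μ) L x₀ := by
  have hi : Integrable (F' x₀) μ := hb.mono' hF' (Filter.Eventually.of_forall (hle x₀))
  have he : L = ∫ y, F' x₀ y ∂μ := by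
    ext v
    rw [ContinuousLinearMap.integral_apply hi, hL v (hi.apply_continuousLinearMap v)]
  rw [he]
  exact hasFDerivAt_integral_of_dominated_of_fderiv_le (s := Set.univ) Filter.univ_mem
    (Filter.Eventually.of_forall fun x => (hF x).aestronglyMeasurable) (hF x₀) hF'
    (Filter.Eventually.of_forall fun y x _ => hle x y) hb
    (Filter.Eventually.of_forall fun y x _ => hd x y)

section Ridge

variable {E : Type*} [NormedAddCommGroup E] [InnerProductSpace ℝ E]

/-- The linear form `x ↦ ⟨x, w⟩`. -/
noncomputable def innerForm (w : E) : E →L[ℝ] ℝ := innerSL ℝ w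

lemma innerForm_apply (w x : E) : innerForm w x = inner ℝ x w := by
  rw [innerForm, innerSL_apply_apply, real_inner_comm]

lemma norm_innerForm (w : E) : ‖innerForm w‖ = ‖w‖ := innerSL_apply_norm ℝ w

/-- The algebra homomorphism that takes `g` to the ridge function `x ↦ g ⟨x, w⟩`. -/
noncomputable def ridge (w : E) : SmoothFn ℝ →ₐ[ℝ] SmoothFn E where
  toFun g := ⟨fun x => (g : ℝ → ℝ) (inner ℝ x w),
    (SmoothFn.contDiff g).comp (contDiff_id.inner ℝ contDiff_const)⟩
  map_one' := rfl
  map_mul' _ _ := rfl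
  map_zero' := rfl
  map_add' _ _ := rfl
  commutes' _ := rfl

lemma ridge_apply (w : E) (g : SmoothFn ℝ) (x : E) :
    (ridge w g : E → ℝ) x = (g : ℝ → ℝ) (inner ℝ x w) := rfl

lemma norm_iteratedFDeriv_ridge_le (w : E) (g : SmoothFn ℝ) (i : ℕ) (x : E) :
    ‖iteratedFDeriv ℝ i (ridge w g : E → ℝ) x‖ ≤
      ‖iteratedFDeriv ℝ i (g : ℝ → ℝ) (inner ℝ x w)‖ * ‖w‖ ^ i := by
  have h : (ridge w g : E → ℝ) = (g : ℝ → ℝ) ∘ innerForm w := by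
    funext y
    rw [Function.comp_apply, innerForm_apply, ridge_apply]
  rw [h, (innerForm w).iteratedFDeriv_comp_right (SmoothFn.contDiff_nat g i) x le_rfl,
    innerForm_apply]
  refine (ContinuousMultilinearMap.norm_compContinuousLinearMap_le _ _).trans ?_
  simp [norm_innerForm]

/-- The derivatives in `x` are those of the jointly smooth function `(w, x) ↦ g ⟨x, w⟩`, restricted
to the second factor. -/
lemma continuous_iteratedFDeriv_ridge (g : SmoothFn ℝ) (i : ℕ) :
    Continuous fun p : E × E => iteratedFDeriv ℝ i (ridge p.1 g : E → ℝ) p.2 := by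
  let G : E × E → ℝ := fun p => (g : ℝ → ℝ) (inner ℝ p.2 p.1)
  have hG : ContDiff ℝ ∞ G := (SmoothFn.contDiff g).comp (contDiff_snd.inner ℝ contDiff_fst)
  have key : ∀ p : E × E, iteratedFDeriv ℝ i (ridge p.1 g : E → ℝ) p.2 =
      (iteratedFDeriv ℝ i G p).compContinuousLinearMap
        fun _ => ContinuousLinearMap.inr ℝ E E := by
    intro p
    have h1 : (ridge p.1 g : E → ℝ) =
        (fun q : E × E => G ((p.1, 0) + q)) ∘ ContinuousLinearMap.inr ℝ E E := by
      funext y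
      simp [G, ridge_apply]
    have hG' : ContDiff ℝ i (fun q : E × E => G ((p.1, 0) + q)) :=
      (hG.comp (contDiff_const.add contDiff_id)).of_le (by exact_mod_cast le_top)
    rw [h1, (ContinuousLinearMap.inr ℝ E E).iteratedFDeriv_comp_right hG' p.2 le_rfl,
      iteratedFDeriv_comp_add_left]
    simp
  simp_rw [key]
  exact (ContinuousMultilinearMap.compContinuousLinearMapL
    fun _ : Fin i => ContinuousLinearMap.inr ℝ E E).continuous.comp
    (hG.continuous_iteratedFDeriv (by exact_mod_cast le_top))

variable {Y : Type*} [TopologicalSpace Y] [SecondCountableTopology Y] [MeasurableSpace Y]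
  [OpensMeasurableSpace Y] {μ : Measure Y} {ι : Y → E} {a : Y → ℝ} {g : SmoothFn ℝ} {c : ℕ → ℝ}

lemma integrable_iteratedFDeriv_ridge (hι : Continuous ι) (ha : Continuous a)
    (hai : ∀ i, Integrable (fun y => |a y| * ‖ι y‖ ^ i) μ)
    (hg : ∀ i t, ‖iteratedFDeriv ℝ i (g : ℝ → ℝ) t‖ ≤ c i) (i : ℕ) (x : E) :
    Integrable (fun y => a y • iteratedFDeriv ℝ i (ridge (ι y) g : E → ℝ) x) μ := by
  refine ((hai i).const_mul (c i)).mono' ?_ ?_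
  · exact (ha.smul ((continuous_iteratedFDeriv_ridge g i).comp
      (hι.prodMk continuous_const))).aestronglyMeasurable
  · refine Filter.Eventually.of_forall fun y => ?_
    rw [norm_smul, Real.norm_eq_abs, mul_left_comm]
    exact mul_le_mul_of_nonneg_left ((norm_iteratedFDeriv_ridge_le _ _ _ _).trans
      (mul_le_mul_of_nonneg_right (hg i _) (by positivity))) (abs_nonneg _)

/-- A superposition of ridge functions is smooth and may be differentiated under the integral. -/
lemma hasFTaylorSeriesUpTo_integral_ridge (hι : Continuous ι) (ha : Continuous a)
    (hai : ∀ i, Integrable (fun y => |a y| * ‖ι y‖ ^ i) μ)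
    (hg : ∀ i t, ‖iteratedFDeriv ℝ i (g : ℝ → ℝ) t‖ ≤ c i) :
    HasFTaylorSeriesUpTo ∞ (fun x => ∫ y, a y * (g : ℝ → ℝ) (inner ℝ x (ι y)) ∂μ)
      fun x i => ∫ y, a y • iteratedFDeriv ℝ i (ridge (ι y) g : E → ℝ) x ∂μ := by
  have hint := fun i x => integrable_iteratedFDeriv_ridge (x := x) hι ha hai hg i
  have hd : ∀ i x, HasFDerivAt
      (fun x => ∫ y, a y • iteratedFDeriv ℝ i (ridge (ι y) g : E → ℝ) x ∂μ)
      (∫ y, a y • iteratedFDeriv ℝ (i + 1) (ridge (ι y) g : E → ℝ) x ∂μ).curryLeft x := by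
    intro i x
    refine hasFDerivAt_integral_of_apply
      (bound := fun y => c (i + 1) * (|a y| * ‖ι y‖ ^ (i + 1)))
      (F' := fun x y => (a y • iteratedFDeriv ℝ (i + 1) (ridge (ι y) g : E → ℝ) x).curryLeft)
      (fun x => hint i x) ?_ ((hai (i + 1)).const_mul _) ?_ ?_ ?_
    · exact (continuousMultilinearCurryLeftEquiv ℝ (fun _ : Fin (i + 1) => E)
        ℝ).continuous.comp_aestronglyMeasurable (hint (i + 1) x).aestronglyMeasurable
    · intro x y
      rw [ContinuousMultilinearMap.curryLeft_norm, norm_smul, Real.norm_eq_abs, mul_left_comm]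
      exact mul_le_mul_of_nonneg_left ((norm_iteratedFDeriv_ridge_le _ _ _ _).trans
        (mul_le_mul_of_nonneg_right (hg _ _) (by positivity))) (abs_nonneg _)
    · intro x y
      have h1 : HasFDerivAt (iteratedFDeriv ℝ i (ridge (ι y) g : E → ℝ))
          (iteratedFDeriv ℝ (i + 1) (ridge (ι y) g : E → ℝ) x).curryLeft x :=
        ((SmoothFn.contDiff (ridge (ι y) g)).ftaylorSeries).fderiv i
          (by exact_mod_cast WithTop.coe_lt_top i) x
      exact h1.const_smul (a y)
    · intro v hv
      ext m
      rw [ContinuousMultilinearMap.curryLeft_apply,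
        ContinuousMultilinearMap.integral_apply (hint (i + 1) x),
        ContinuousMultilinearMap.integral_apply hv]
      rfl
  refine ⟨fun x => ?_, fun i _ x => hd i x, fun i _ =>
    continuous_iff_continuousAt.2 fun x => (hd i x).continuousAt⟩
  rw [ContinuousMultilinearMap.curry0, ContinuousMultilinearMap.integral_apply (hint 0 x)]
  rfl

/-- The superposition of ridge functions, as a smooth function. -/
noncomputable def ridgeIntegral (hι : Continuous ι) (ha : Continuous a)
    (hai : ∀ i, Integrable (fun y => |a y| * ‖ι y‖ ^ i) μ)
    (hg : ∀ i t, ‖iteratedFDeriv ℝ i (g : ℝ → ℝ) t‖ ≤ c i) : SmoothFn E :=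
  ⟨fun x => ∫ y, a y * (g : ℝ → ℝ) (inner ℝ x (ι y)) ∂μ,
    (hasFTaylorSeriesUpTo_integral_ridge hι ha hai hg).contDiff⟩

/-- A functional of finite order commutes with superpositions of ridge functions. -/
lemma HasOrderOn.apply_ridgeIntegral {K : Set E} {N : ℕ} [CompactSpace K]
    {T : SmoothFn E →ₗ[ℝ] ℝ} (hT : HasOrderOn K N T) (hι : Continuous ι) (ha : Continuous a)
    (hai : ∀ i, Integrable (fun y => |a y| * ‖ι y‖ ^ i) μ)
    (hg : ∀ i t, ‖iteratedFDeriv ℝ i (g : ℝ → ℝ) t‖ ≤ c i) :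
    T (ridgeIntegral hι ha hai hg) = ∫ y, a y * T (ridge (ι y) g) ∂μ := by
  obtain ⟨φ, hφ⟩ := hT
  have hc : ∀ i, 0 ≤ c i := fun i => (norm_nonneg _).trans (hg i 0)
  have hcont : Continuous fun y => a y • jet K N (ridge (ι y) g) := by
    refine ha.smul (JetSpace.continuous_of_eval fun i => ?_)
    simp only [JetSpace.evalL_jet]
    exact (continuous_iteratedFDeriv_ridge g i).comp
      ((hι.comp continuous_fst).prodMk (continuous_subtype_val.comp continuous_snd))
  have hint : Integrable (fun y => a y • jet K N (ridge (ι y) g)) μ := by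
    refine (integrable_finsetSum (Finset.range (N + 1))
      fun i _ => (hai i).const_mul (c i)).mono' hcont.aestronglyMeasurable ?_
    refine Filter.Eventually.of_forall fun y => ?_
    have hnn : ∀ i, 0 ≤ c i * (|a y| * ‖ι y‖ ^ i) := fun i =>
      mul_nonneg (hc i) (by positivity)
    refine JetSpace.norm_le (Finset.sum_nonneg fun i _ => hnn i) fun i x => ?_
    rw [map_smul, JetSpace.evalL_jet, norm_smul, Real.norm_eq_abs]
    refine le_trans ?_ (Finset.single_le_sum (f := fun i => c i * (|a y| * ‖ι y‖ ^ i))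
      (fun i _ => hnn i) (Finset.mem_range.2 i.2))
    rw [mul_left_comm]
    exact mul_le_mul_of_nonneg_left ((norm_iteratedFDeriv_ridge_le _ _ _ _).trans
      (mul_le_mul_of_nonneg_right (hg _ _) (by positivity))) (abs_nonneg _)
  -- The jet of the superposition is the Bochner integral of the jets, through which the continuous
  -- functional `φ` passes.
  have hjet : jet K N (ridgeIntegral hι ha hai hg) = ∫ y, a y • jet K N (ridge (ι y) g) ∂μ := by
    refine JetSpace.ext_evalL fun i x => ?_
    rw [← ContinuousLinearMap.integral_comp_comm _ hint, JetSpace.evalL_jet]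
    have h := (hasFTaylorSeriesUpTo_integral_ridge hι ha hai hg).eq_iteratedFDeriv (m := i)
      (by exact_mod_cast le_top) x
    refine h.symm.trans ?_
    simp only [map_smul, JetSpace.evalL_jet]
  rw [hφ, hjet, ← ContinuousLinearMap.integral_comp_comm _ hint]
  simp only [map_smul, hφ, smul_eq_mul]

end Ridge

end RadonSupport

/-! ### Functionals of one variable supported in two points. -/

namespace RadonSupport

section OneVariable

/-- A bound for the derivatives of `u'` on `[-R, R]` gives one for those of `u` if `u 0 = 0`. -/
lemma abs_iteratedDeriv_le_of_deriv {u : ℝ → ℝ} (hu : Differentiable ℝ u) (h0 : u 0 = 0) {N : ℕ}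
    {R B : ℝ} (hR : 0 ≤ R)
    (h : ∀ i ≤ N, ∀ t, |t| ≤ R → |iteratedDeriv i (deriv u) t| ≤ B) :
    ∀ i ≤ N + 1, ∀ t, |t| ≤ R → |iteratedDeriv i u t| ≤ (1 + R) * B := by
  have hB : 0 ≤ B := (abs_nonneg _).trans (h 0 (Nat.zero_le _) 0 (by simpa using hR))
  rintro (_ | i) hi t ht
  · rw [iteratedDeriv_zero]
    have h1 := (convex_Icc (-R) R).norm_image_sub_le_of_norm_deriv_le (f := u) (C := B)
      (x := 0) (y := t) (fun x _ => hu x)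
      (fun x hx => by simpa using h 0 (Nat.zero_le _) x (abs_le.2 hx))
      ⟨by linarith, hR⟩ (abs_le.1 ht)
    rw [h0, sub_zero, sub_zero, Real.norm_eq_abs, Real.norm_eq_abs] at h1
    nlinarith [mul_le_mul_of_nonneg_left ht hB]
  · rw [iteratedDeriv_succ']
    have := h i (by omega) t ht
    nlinarith [mul_nonneg hR hB]

lemma exists_derivative_eq (P : Polynomial ℝ) (c : ℝ) :
    ∃ Q : Polynomial ℝ, Q.derivative = P ∧ Q.eval 0 = c := by
  have h : ∃ Q : Polynomial ℝ, Q.derivative = P := by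
    induction P using Polynomial.induction_on' with
    | add p q hp hq =>
      obtain ⟨p', rfl⟩ := hp
      obtain ⟨q', rfl⟩ := hq
      exact ⟨p' + q', Polynomial.derivative_add⟩
    | monomial n a =>
      refine ⟨Polynomial.monomial (n + 1) (a / (n + 1)), ?_⟩
      rw [Polynomial.derivative_monomial]
      have : (n : ℝ) + 1 ≠ 0 := by positivity
      simp [this]
  obtain ⟨Q, hQ⟩ := h
  exact ⟨Q + Polynomial.C (c - Q.eval 0), by simp [hQ], by simp⟩

/-- Polynomials are dense in the smooth functions, with derivatives on bounded sets. -/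
lemma exists_polynomial_iteratedDeriv_near (N : ℕ) {R : ℝ} (hR : 0 ≤ R) :
    ∀ {g : ℝ → ℝ}, ContDiff ℝ ∞ g → ∀ {ε : ℝ}, 0 < ε → ∃ P : Polynomial ℝ,
      ∀ i ≤ N, ∀ t, |t| ≤ R → |iteratedDeriv i (fun s => g s - P.eval s) t| ≤ ε := by
  induction N with
  | zero =>
    intro g hg ε hε
    obtain ⟨P, hP⟩ := exists_polynomial_near_of_continuousOn (-R) R g
      hg.continuous.continuousOn ε hε
    refine ⟨P, fun i hi t ht => ?_⟩
    rw [Nat.le_zero.1 hi, iteratedDeriv_zero, abs_sub_comm]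
    exact (hP t (abs_le.1 ht)).le
  | succ N ih =>
    intro g hg ε hε
    -- Approximate the derivative and integrate, with the value at `0` matched; integration over
    -- `[-R, R]` costs a factor `1 + R`.
    obtain ⟨P, hP⟩ := ih (contDiff_infty_iff_deriv.1 hg).2 (ε := ε / (1 + R)) (by positivity)
    obtain ⟨Q, rfl, hQ0⟩ := exists_derivative_eq P (g 0)
    refine ⟨Q, ?_⟩
    have hgd : Differentiable ℝ g := hg.differentiable (by simp)
    have hd : deriv (fun s => g s - Q.eval s) = fun s => deriv g s - Q.derivative.eval s := by
      funext s
      rw [deriv_fun_sub (hgd s) Q.differentiable.differentiableAt, Polynomial.deriv]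
    have h := abs_iteratedDeriv_le_of_deriv (u := fun s => g s - Q.eval s) (N := N)
      (B := ε / (1 + R)) (hgd.sub Q.differentiable) (by simp [hQ0]) hR (by rwa [hd])
    rwa [mul_div_cancel₀ _ (by positivity)] at h

/-- `t ^ (N + 1)` is a limit, with derivatives of order at most `N`, of smooth functions that
vanish near `0`. -/
lemma exists_eventually_zero_iteratedDeriv_near {R : ℝ} (hR : 0 ≤ R) (N : ℕ) :
    ∀ {ε : ℝ}, 0 < ε → ∃ h : ℝ → ℝ, ContDiff ℝ ∞ h ∧ (∀ᶠ t in 𝓝 0, h t = 0) ∧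
      ∀ i ≤ N, ∀ t, |t| ≤ R → |iteratedDeriv i (fun s => h s - s ^ (N + 1)) t| ≤ ε := by
  induction N with
  | zero =>
    intro ε hε
    -- `t * (1 - b t)` differs from `t` only where `|t| < ε`, and there by at most `ε`.
    let b : ContDiffBump (0 : ℝ) := ⟨ε / 2, ε, by positivity, by linarith⟩
    refine ⟨fun t => t * (1 - b t), contDiff_id.mul (contDiff_const.sub b.contDiff), ?_, ?_⟩
    · filter_upwards [b.eventuallyEq_one] with t ht
      rw [ht]
      simp
    · intro i hi t _
      rw [Nat.le_zero.1 hi, iteratedDeriv_zero, zero_add, pow_one]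
      have : t * (1 - b t) - t = - (t * b t) := by ring
      rw [this, abs_neg, abs_mul, abs_of_nonneg b.nonneg]
      by_cases ht : |t| < ε
      · calc |t| * b t ≤ |t| * 1 := mul_le_mul_of_nonneg_left b.le_one (abs_nonneg _)
          _ ≤ ε := by linarith
      · rw [b.zero_of_le_dist (by simpa using not_lt.1 ht), mul_zero]
        exact hε.le
  | succ N ih =>
    intro ε hε
    -- The next function is the primitive of `(N + 2) * h`, since `(t ^ (N + 2))' = (N + 2) t ^ (N +
    -- 1)`; the divisors of `ε` compensate this factor and the integration.
    obtain ⟨h, hh, h0, hN⟩ := ih (ε := ε / (1 + R) / (N + 2)) (by positivity)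
    have hd : ∀ t, HasDerivAt (fun s => ∫ x in (0 : ℝ)..s, (N + 2) * h x) ((N + 2) * h t) t :=
      fun t => intervalIntegral.integral_hasDerivAt_right
        ((continuous_const.mul hh.continuous).intervalIntegrable _ _)
        ((continuous_const.mul hh.continuous).stronglyMeasurableAtFilter _ _)
        (continuous_const.mul hh.continuous).continuousAt
    have hdd : deriv (fun s => ∫ x in (0 : ℝ)..s, (N + 2) * h x) = fun t => (N + 2) * h t :=
      funext fun t => (hd t).deriv
    refine ⟨fun s => ∫ x in (0 : ℝ)..s, (N + 2) * h x, ?_, ?_, ?_⟩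
    · rw [contDiff_infty_iff_deriv, hdd]
      exact ⟨fun t => (hd t).differentiableAt, contDiff_const.mul hh⟩
    · obtain ⟨δ, hδ, hb⟩ := Metric.eventually_nhds_iff.1 h0
      filter_upwards [Metric.ball_mem_nhds (0 : ℝ) hδ] with t ht
      refine intervalIntegral.integral_zero_ae (Filter.Eventually.of_forall fun x hx => ?_)
      rw [hb, mul_zero]
      rw [Metric.mem_ball, Real.dist_eq, sub_zero] at ht
      rw [Real.dist_eq, sub_zero]
      refine lt_of_le_of_lt ?_ ht
      have := Set.abs_sub_left_of_mem_uIcc (Set.uIoc_subset_uIcc hx)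
      simpa using this
    · have hd2 : deriv (fun s => (∫ x in (0 : ℝ)..s, (N + 2) * h x) - s ^ (N + 1 + 1)) =
          (N + 2 : ℝ) • fun s => h s - s ^ (N + 1) := by
        funext s
        refine ((hd s).sub (hasDerivAt_pow (N + 1 + 1) s)).deriv.trans ?_
        rw [Pi.smul_apply, smul_eq_mul, Nat.add_sub_cancel]
        push_cast
        ring
      have hB := abs_iteratedDeriv_le_of_deriv
        (u := fun s => (∫ x in (0 : ℝ)..s, (N + 2) * h x) - s ^ (N + 1 + 1)) (N := N)
        (B := ε / (1 + R)) (fun t => ((hd t).sub (hasDerivAt_pow _ t)).differentiableAt)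
        (by simp) hR ?_
      · rwa [mul_div_cancel₀ _ (by positivity)] at hB
      · intro i hi t ht
        rw [hd2, iteratedDeriv_const_smul_field, smul_eq_mul, abs_mul,
          abs_of_nonneg (by positivity)]
        have := hN i hi t ht
        rwa [le_div_iff₀' (by positivity)] at this

/-- A functional on smooth functions of one variable that is bounded by the derivatives of order
at most `N` on `[-R, R]`. -/
def IsBoundedOn (S : SmoothFn ℝ →ₗ[ℝ] ℝ) (N : ℕ) (R : ℝ) : Prop :=
  ∃ c : ℝ, 0 ≤ c ∧ ∀ g : SmoothFn ℝ, ∀ B : ℝ, 0 ≤ B →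
    (∀ i ≤ N, ∀ t, |t| ≤ R → ‖iteratedFDeriv ℝ i (g : ℝ → ℝ) t‖ ≤ B) → |S g| ≤ c * B

lemma eq_zero_of_forall_abs_le {x c : ℝ} (hc : 0 ≤ c) (h : ∀ ε > 0, |x| ≤ c * ε) : x = 0 := by
  refine abs_nonpos_iff.1 (le_of_forall_pos_le_add fun δ hδ => ?_)
  have h1 := h (δ / (c + 1)) (by positivity)
  have h2 : c * (δ / (c + 1)) ≤ δ := by
    rw [mul_div_assoc', div_le_iff₀ (by positivity)]
    nlinarith
  linarith

/-- The identity function of `ℝ`. -/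
def idFn : SmoothFn ℝ := ⟨fun t => t, (contDiff_id : ContDiff ℝ ∞ fun t : ℝ => t)⟩

lemma aeval_idFn_apply (P : Polynomial ℝ) (t : ℝ) :
    (Polynomial.aeval idFn P : ℝ → ℝ) t = P.eval t := by
  have h := Polynomial.aeval_algHom_apply
    ((Pi.evalAlgHom ℝ (fun _ : ℝ => ℝ) t).comp (SmoothFn ℝ).val) idFn P
  rw [← Polynomial.coe_aeval_eq_eval]
  exact h.symm

lemma IsBoundedOn.eq_zero_of_polynomial {S : SmoothFn ℝ →ₗ[ℝ] ℝ} {N : ℕ} {R : ℝ} (hR : 0 ≤ R)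
    (hS : IsBoundedOn S N R) (h : ∀ P : Polynomial ℝ, S (Polynomial.aeval idFn P) = 0)
    (g : SmoothFn ℝ) : S g = 0 := by
  obtain ⟨c, hc, hb⟩ := hS
  refine eq_zero_of_forall_abs_le hc fun ε hε => ?_
  obtain ⟨P, hP⟩ := exists_polynomial_iteratedDeriv_near N hR (SmoothFn.contDiff g) hε
  have h1 : S g = S (g - Polynomial.aeval idFn P) := by rw [map_sub, h, sub_zero]
  rw [h1]
  refine hb _ _ hε.le fun i hi t ht => ?_
  rw [norm_iteratedFDeriv_eq_norm_iteratedDeriv]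
  have h2 : ((g - Polynomial.aeval idFn P : SmoothFn ℝ) : ℝ → ℝ) =
      fun s => (g : ℝ → ℝ) s - P.eval s := by
    funext s
    rw [← aeval_idFn_apply]
    rfl
  rw [h2]
  exact hP i hi t ht

/-- The power `(t - ρ) ^ (N + 1)` is a limit, to order `N`, of functions that vanish near `ρ`, and
multiplication by `v` preserves this convergence. -/
lemma IsBoundedOn.apply_mul_pow_eq_zero {S : SmoothFn ℝ →ₗ[ℝ] ℝ} {N : ℕ} {R : ℝ} (hR : 0 ≤ R)
    (hS : IsBoundedOn S N R) {v : SmoothFn ℝ} {ρ : ℝ}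
    (h : ∀ u : SmoothFn ℝ, (∀ᶠ t in 𝓝 ρ, (u : ℝ → ℝ) t = 0) → S (v * u) = 0) :
    S (v * Polynomial.aeval idFn ((Polynomial.X - Polynomial.C ρ) ^ (N + 1))) = 0 := by
  obtain ⟨c, hc, hb⟩ := hS
  have hA : ∃ A : ℝ, 0 ≤ A ∧ ∀ i ≤ N, ∀ t, |t| ≤ R → ‖iteratedFDeriv ℝ i (v : ℝ → ℝ) t‖ ≤ A := by
    choose A hA using fun i => (isCompact_Icc (a := -R) (b := R)).exists_bound_of_continuousOn
      (SmoothFn.continuous_iteratedFDeriv v i).continuousOn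
    have hA0 : ∀ i, 0 ≤ A i := fun i => (norm_nonneg _).trans (hA i 0 ⟨by linarith, hR⟩)
    refine ⟨∑ i ∈ Finset.range (N + 1), A i, Finset.sum_nonneg fun i _ => hA0 i,
      fun i hi t ht => (hA i t (abs_le.1 ht)).trans ?_⟩
    exact Finset.single_le_sum (fun i _ => hA0 i) (Finset.mem_range.2 (by omega))
  obtain ⟨A, hA0, hA⟩ := hA
  refine eq_zero_of_forall_abs_le (c := c * (2 ^ N * A)) (by positivity) fun ε hε => ?_
  -- Translation by `ρ` carries `[-R, R]` into the interval of radius `R + |ρ|`.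
  obtain ⟨k, hk, hk0, hkN⟩ := exists_eventually_zero_iteratedDeriv_near
    (R := R + |ρ|) (by positivity) N hε
  let u : SmoothFn ℝ := ⟨fun t => k (t - ρ), hk.comp (contDiff_id.sub contDiff_const)⟩
  have hu : ∀ᶠ t in 𝓝 ρ, (u : ℝ → ℝ) t = 0 := by
    have : Filter.Tendsto (fun t => t - ρ) (𝓝 ρ) (𝓝 0) := by
      have h : Continuous fun t : ℝ => t - ρ := by fun_prop
      simpa using h.tendsto ρ
    exact this.eventually hk0
  set q := Polynomial.aeval idFn ((Polynomial.X - Polynomial.C ρ) ^ (N + 1))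
  have h1 : S (v * q) = - S (v * (u - q)) := by
    rw [mul_sub, map_sub, h u hu]
    ring
  have h2 : ((u - q : SmoothFn ℝ) : ℝ → ℝ) = fun s => (fun s => k s - s ^ (N + 1)) (s - ρ) := by
    funext s
    change k (s - ρ) - (q : ℝ → ℝ) s = _
    rw [aeval_idFn_apply]
    simp
  rw [h1, abs_neg, mul_assoc, mul_assoc]
  refine hb _ _ (by positivity) fun i hi t ht => ?_
  refine norm_iteratedFDeriv_mul_le_of_le v (u - q) hA0 (fun j hj => hA j hj t ht) ?_ hi
  intro j hj
  rw [h2, iteratedFDeriv_comp_sub (f := fun s => k s - s ^ (N + 1)),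
    norm_iteratedFDeriv_eq_norm_iteratedDeriv]
  exact hkN j hj _ ((abs_sub _ _).trans (by linarith))

/-- A functional of order at most `N` supported in two points is annihilated by the powers of order
`N + 1` of the polynomial that vanishes at these points. -/
lemma IsBoundedOn.apply_polynomial_eq_zero {S : SmoothFn ℝ →ₗ[ℝ] ℝ} {N : ℕ} {R : ℝ} (hR : 0 ≤ R)
    (hS : IsBoundedOn S N R) {ρ₁ ρ₂ : ℝ}
    (h : ∀ u : SmoothFn ℝ, (∀ᶠ t in 𝓝 ρ₁, (u : ℝ → ℝ) t = 0) →
      (∀ᶠ t in 𝓝 ρ₂, (u : ℝ → ℝ) t = 0) → S u = 0) (P : Polynomial ℝ) :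
    S (Polynomial.aeval idFn (((Polynomial.X - Polynomial.C ρ₁) *
      (Polynomial.X - Polynomial.C ρ₂)) ^ (N + 1) * P)) = 0 := by
  -- One point at a time: the factor at `ρ₁` is produced first, with a cofactor `u` that still
  -- vanishes near `ρ₂`.
  have h1 : ∀ u : SmoothFn ℝ, (∀ᶠ t in 𝓝 ρ₂, (u : ℝ → ℝ) t = 0) → S (Polynomial.aeval idFn P * u *
      Polynomial.aeval idFn ((Polynomial.X - Polynomial.C ρ₁) ^ (N + 1))) = 0 := by
    intro u hu
    refine hS.apply_mul_pow_eq_zero hR fun k hk => h _ ?_ ?_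
    · filter_upwards [hk] with t ht
      change _ * _ * (k : ℝ → ℝ) t = 0
      rw [ht, mul_zero]
    · filter_upwards [hu] with t ht
      change _ * (u : ℝ → ℝ) t * _ = 0
      rw [ht, mul_zero, zero_mul]
  have h2 := hS.apply_mul_pow_eq_zero (v := Polynomial.aeval idFn P *
    Polynomial.aeval idFn ((Polynomial.X - Polynomial.C ρ₁) ^ (N + 1))) (ρ := ρ₂) hR
    fun u hu => by rw [mul_right_comm]; exact h1 u hu
  rw [← Polynomial.aeval_mul, ← Polynomial.aeval_mul] at h2
  have h3 : ((Polynomial.X - Polynomial.C ρ₁) * (Polynomial.X - Polynomial.C ρ₂)) ^ (N + 1) * P =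
      P * (Polynomial.X - Polynomial.C ρ₁) ^ (N + 1) *
        (Polynomial.X - Polynomial.C ρ₂) ^ (N + 1) := by
    rw [mul_pow]
    ac_rfl
  rw [h3]
  exact h2

/-- The projection of `K` lies in `[-R ‖w‖, R ‖w‖]`, and the chain-rule factors `‖w‖ ^ i` are
absorbed by `(1 + ‖w‖) ^ N`. -/
lemma HasOrderOn.isBoundedOn_ridge {E : Type*} [NormedAddCommGroup E] [InnerProductSpace ℝ E]
    {K : Set E} {N : ℕ} [CompactSpace K] {T : SmoothFn E →ₗ[ℝ] ℝ} (hT : HasOrderOn K N T)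
    {R : ℝ} (hK : K ⊆ Metric.closedBall 0 R) (w : E) :
    IsBoundedOn (T.comp (ridge w).toLinearMap) N (R * ‖w‖) := by
  obtain ⟨c, hc, hb⟩ := hT.exists_bound
  have hw : 1 ≤ 1 + ‖w‖ := by linarith [norm_nonneg w]
  refine ⟨c * (1 + ‖w‖) ^ N, by positivity, fun g B hB h => ?_⟩
  rw [mul_assoc]
  refine hb (ridge w g) _ (by positivity) fun i hi x hx => ?_
  refine (norm_iteratedFDeriv_ridge_le w g i x).trans ?_
  rw [mul_comm]
  refine mul_le_mul ?_ (h i hi _ ?_) (norm_nonneg _) (by positivity)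
  · exact (pow_le_pow_left₀ (norm_nonneg w) (by linarith) i).trans (pow_le_pow_right₀ hw hi)
  · exact (abs_real_inner_le_norm x w).trans
      (mul_le_mul_of_nonneg_right (by simpa using hK hx) (norm_nonneg _))

end OneVariable

end RadonSupport

/-! ### From the Radon transform to the projections in single directions. -/

namespace RadonSupport

lemma HasOrderOn.continuous_ridge {E : Type*} [NormedAddCommGroup E] [InnerProductSpace ℝ E]
    {K : Set E} {N : ℕ} [CompactSpace K] {T : SmoothFn E →ₗ[ℝ] ℝ} (hT : HasOrderOn K N T)
    (g : SmoothFn ℝ) : Continuous fun w : E => T (ridge w g) := by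
  obtain ⟨φ, hφ⟩ := hT
  simp only [hφ]
  refine φ.continuous.comp (JetSpace.continuous_of_eval fun i => ?_)
  simp only [JetSpace.evalL_jet]
  exact (continuous_iteratedFDeriv_ridge g i).comp
    (continuous_fst.prodMk (continuous_subtype_val.comp continuous_snd))

lemma exists_norm_iteratedFDeriv_le {g : SmoothFn ℝ} (hg : HasCompactSupport (g : ℝ → ℝ)) :
    ∃ c : ℕ → ℝ, ∀ i t, ‖iteratedFDeriv ℝ i (g : ℝ → ℝ) t‖ ≤ c i := by
  choose c hc using fun i => (hg.iteratedFDeriv (𝕜 := ℝ) i).exists_bound_of_continuous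
    (SmoothFn.continuous_iteratedFDeriv g i)
  exact ⟨c, hc⟩

/-- The functional `u ↦ L ⟨f, χ u⟩` on smooth functions. -/
noncomputable def cutDistribution {n : ℕ} (f : 𝓓'((⊤ : Opens (Euc n)), ℂ))
    (χ : 𝓓((⊤ : Opens (Euc n)), ℝ)) (L : ℂ →L[ℝ] ℝ) : SmoothFn (Euc n) →ₗ[ℝ] ℝ :=
  (L.comp (f : 𝓓((⊤ : Opens (Euc n)), ℝ) →L[ℝ] ℂ)).toLinearMap.comp (mulTest χ)

lemma cutDistribution_apply {n : ℕ} (f : 𝓓'((⊤ : Opens (Euc n)), ℂ))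
    (χ : 𝓓((⊤ : Opens (Euc n)), ℝ)) (L : ℂ →L[ℝ] ℝ) (u : SmoothFn (Euc n)) :
    cutDistribution f χ L u = L (f (mulTest χ u)) := rfl

section Radon

variable {n : ℕ} {f : 𝓓'((⊤ : Opens (Euc n)), ℂ)} {χ : 𝓓((⊤ : Opens (Euc n)), ℝ)}
  {L : ℂ →L[ℝ] ℝ} {K : Set (Euc n)} {N : ℕ} [CompactSpace K]

/-- Off the support of the Radon transform, the projections of the distribution vanish. -/
lemma exists_cutDistribution_ridge_eq_zero (hf : IsCompact (dsupport f))
    (hχ : ∀ᶠ x in 𝓝ˢ (dsupport f), χ x = 1) (hT : HasOrderOn K N (cutDistribution f χ L))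
    {ξ : Sph n} {p : ℝ} (hp : (ξ, p) ∉ dsupport (radonTransform f)) :
    ∃ U : Set ℝ, IsOpen U ∧ p ∈ U ∧ ∀ g : SmoothFn ℝ, HasCompactSupport (g : ℝ → ℝ) →
      tsupport (g : ℝ → ℝ) ⊆ U → cutDistribution f χ L (ridge (ξ : Euc n) g) = 0 := by
  obtain ⟨V, hV, hVo, hpV⟩ := (notMem_dsupport_iff (f := (radonTransform f : _ → ℂ)) _).1 hp
  obtain ⟨A, U, hAo, hUo, hξA, hpU, hAU⟩ := isOpen_prod_iff.1 hVo ξ p hpV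
  refine ⟨U, hUo, hpU, fun g hgc hgU => ?_⟩
  -- The Radon transform controls only averages over directions. If the value `s` at `ξ` is nonzero,
  -- then by continuity `s * T (ridge w g)` is positive near `ξ`, so its average against a bump at
  -- `ξ` is positive; but that average is a multiple of a vanishing value of the Radon transform.
  by_contra hne
  set T := cutDistribution f χ L with hTdef
  set s := T (ridge (ξ : Euc n) g) with hs
  have hF := hT.continuous_ridge g
  obtain ⟨A', hA'o, rfl⟩ := isOpen_induced_iff.1 hAo
  have hpos : {w : Euc n | 0 < s * T (ridge w g)} ∈ 𝓝 (ξ : Euc n) :=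
    (isOpen_lt continuous_const (continuous_const.mul hF)).mem_nhds
      (by rw [Set.mem_ofPred_eq, ← hs]; exact mul_self_pos.2 hne)
  obtain ⟨r, hr, hrs⟩ := Metric.nhds_basis_closedBall.mem_iff.1
    (Filter.inter_mem hpos (hA'o.mem_nhds hξA))
  let a : ContDiffBump (ξ : Euc n) := ⟨r / 2, r, by positivity, by linarith⟩
  have ha0 : ∀ w : Euc n, w ∉ Metric.closedBall (ξ : Euc n) r → a w = 0 := fun w hw =>
    a.zero_of_le_dist (by simpa using (not_le.1 hw).le)
  obtain ⟨c, hc⟩ := exists_norm_iteratedFDeriv_le hgc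
  let Φ : 𝓓((⊤ : Opens (Euc n × ℝ)), ℝ) := ⟨fun z => a z.1 * (g : ℝ → ℝ) z.2,
    (a.contDiff.comp contDiff_fst).mul ((SmoothFn.contDiff g).comp contDiff_snd),
    HasCompactSupport.intro (a.hasCompactSupport.isCompact.prod hgc.isCompact) (by
      intro z hz
      rw [Set.mem_prod, not_and_or] at hz
      rcases hz with hz | hz
      · rw [image_eq_zero_of_notMem_tsupport hz, zero_mul]
      · rw [image_eq_zero_of_notMem_tsupport hz, mul_zero]), fun _ _ => trivial⟩
  let φ : CylTest n := ⟨fun z => a (z.1 : Euc n) * (g : ℝ → ℝ) z.2, Φ, fun _ _ => rfl⟩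
  have hφV : tsupport φ ⊆ V := by
    have hcl : IsClosed {z : Sph n × ℝ | (z.1 : Euc n) ∈ Metric.closedBall (ξ : Euc n) r ∧
        z.2 ∈ tsupport (g : ℝ → ℝ)} :=
      (Metric.isClosed_closedBall.preimage (continuous_subtype_val.comp continuous_fst)).inter
        ((isClosed_tsupport _).preimage continuous_snd)
    refine (closure_minimal (fun z hz => ?_) hcl).trans fun z hz => hAU ⟨(hrs hz.1).2, hgU hz.2⟩
    have hz' : a (z.1 : Euc n) * (g : ℝ → ℝ) z.2 ≠ 0 := hz
    refine ⟨by_contra fun h => left_ne_zero_of_mul hz' (ha0 _ h),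
      subset_tsupport _ (right_ne_zero_of_mul hz')⟩
  have hac : Continuous fun η : Sph n => a (η : Euc n) :=
    a.continuous.comp continuous_subtype_val
  have hai : ∀ i, Integrable (fun η : Sph n => |a (η : Euc n)| * ‖(η : Euc n)‖ ^ i)
      (volume : Measure (Euc n)).toSphere := fun i =>
    (hac.abs.mul (continuous_subtype_val.norm.pow i)).integrable_of_hasCompactSupport
      (HasCompactSupport.of_compactSpace _)
  have hzero : ∫ η : Sph n, a (η : Euc n) * T (ridge (η : Euc n) g)
      ∂(volume : Measure (Euc n)).toSphere = 0 := by
    rw [← hT.apply_ridgeIntegral continuous_subtype_val hac hai hc, hTdef,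
      cutDistribution_apply]
    have h1 := hV φ hφV
    rw [radonTransform_apply f hf χ hχ] at h1
    -- The superposition over the sphere with weight `a` is exactly the dual Radon transform of
    -- `a(ξ) g(p)`.
    have h2 : mulTest χ (ridgeIntegral continuous_subtype_val hac hai hc) =
        cutDualRadon χ φ := by
      ext x
      rfl
    rw [h2, h1, map_zero]
  have hcont : Continuous fun η : Sph n => a (η : Euc n) * (s * T (ridge (η : Euc n) g)) :=
    hac.mul (continuous_const.mul (hF.comp continuous_subtype_val))
  have hgt := hcont.integral_pos_of_hasCompactSupport_nonneg_nonzero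
    (μ := (volume : Measure (Euc n)).toSphere) (x := ξ) (HasCompactSupport.of_compactSpace _)
    (fun η => ?_) ?_
  · have h3 : ∫ η : Sph n, a (η : Euc n) * (s * T (ridge (η : Euc n) g))
        ∂(volume : Measure (Euc n)).toSphere = s * ∫ η : Sph n, a (η : Euc n) *
          T (ridge (η : Euc n) g) ∂(volume : Measure (Euc n)).toSphere := by
      rw [← integral_const_mul]
      exact integral_congr_ae (Filter.Eventually.of_forall fun η => mul_left_comm _ _ _)
    rw [h3, hzero, mul_zero] at hgt
    exact lt_irrefl _ hgt
  · by_cases h : (η : Euc n) ∈ Metric.closedBall (ξ : Euc n) r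
    · exact mul_nonneg a.nonneg (hrs h).1.le
    · simp [ha0 _ h]
  · refine mul_ne_zero (ne_of_gt ?_) (mul_self_pos.2 hne).ne'
    exact a.pos_of_mem_ball (Metric.mem_ball_self hr)

end Radon

/-- A functional of one variable that vanishes locally near the support of `v` vanishes at `v`. -/
lemma apply_eq_zero_of_local {S : SmoothFn ℝ →ₗ[ℝ] ℝ} {v : SmoothFn ℝ}
    (hv : HasCompactSupport (v : ℝ → ℝ))
    (h : ∀ p ∈ tsupport (v : ℝ → ℝ), ∃ U : Set ℝ, IsOpen U ∧ p ∈ U ∧ ∀ g : SmoothFn ℝ,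
      HasCompactSupport (g : ℝ → ℝ) → tsupport (g : ℝ → ℝ) ⊆ U → S g = 0) : S v = 0 := by
  choose! U hUo hpU hU using h
  obtain ⟨t, ht⟩ := hv.isCompact.elim_nhds_subcover' (fun x _ => U x)
    (fun x hx => (hUo x hx).mem_nhds (hpU x hx))
  have hcov : tsupport (v : ℝ → ℝ) ⊆ ⋃ i : t, U i := by
    intro x hx
    obtain ⟨i, hi, hx'⟩ := Set.mem_iUnion₂.1 (ht hx)
    exact Set.mem_iUnion.2 ⟨⟨i, hi⟩, hx'⟩
  obtain ⟨ρ, hρ⟩ := SmoothPartitionOfUnity.exists_isSubordinate (modelWithCornersSelf ℝ ℝ)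
    (isClosed_tsupport (v : ℝ → ℝ)) (fun i : t => U i) (fun i => hUo i i.1.2) hcov
  let u : t → SmoothFn ℝ := fun i =>
    ⟨fun x => ρ i x * (v : ℝ → ℝ) x, (ρ i).contMDiff.contDiff.mul (SmoothFn.contDiff v)⟩
  have hsum : v = ∑ i, u i := by
    refine Subtype.ext (funext fun x => ?_)
    have h1 : ((∑ i, u i : SmoothFn ℝ) : ℝ → ℝ) x = ∑ i, ρ i x * (v : ℝ → ℝ) x := by
      rw [AddSubmonoidClass.coe_finsetSum, Finset.sum_apply]
    rw [h1, ← Finset.sum_mul]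
    by_cases hx : x ∈ tsupport (v : ℝ → ℝ)
    · rw [← finsum_eq_sum_of_fintype, ρ.sum_eq_one hx, one_mul]
    · rw [image_eq_zero_of_notMem_tsupport hx, mul_zero]
  rw [hsum, map_sum]
  exact Finset.sum_eq_zero fun i _ => hU i i.1.2 (u i) hv.mul_left
    (tsupport_mul_subset_left.trans (hρ i))

end RadonSupport

/-! ### Localization, polynomial moments, and totality of ridge functions. -/

namespace RadonSupport

section

variable {E : Type*} [NormedAddCommGroup E] [InnerProductSpace ℝ E] {K : Set E} {N : ℕ}
  [CompactSpace K] {T : SmoothFn E →ₗ[ℝ] ℝ}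

/-- `T` sees only germs along `K`, so `u` may be multiplied by a bump equal to `1` near the
projection of `K`; this gives the compact support that a partition of unity needs. -/
lemma HasOrderOn.apply_ridge_eq_zero_of_local (hT : HasOrderOn K N T) {w : E} {ρ₁ ρ₂ : ℝ}
    (h : ∀ p, p ≠ ρ₁ → p ≠ ρ₂ → ∃ U : Set ℝ, IsOpen U ∧ p ∈ U ∧ ∀ g : SmoothFn ℝ,
      HasCompactSupport (g : ℝ → ℝ) → tsupport (g : ℝ → ℝ) ⊆ U → T (ridge w g) = 0)
    {u : SmoothFn ℝ} (h₁ : ∀ᶠ t in 𝓝 ρ₁, (u : ℝ → ℝ) t = 0)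
    (h₂ : ∀ᶠ t in 𝓝 ρ₂, (u : ℝ → ℝ) t = 0) : T (ridge w u) = 0 := by
  obtain ⟨R, hR, hK⟩ := (isCompact_iff_compactSpace.2 ‹_› : IsCompact K).isBounded.subset_ball_lt
    0 (0 : E)
  have hRw : 0 ≤ R * ‖w‖ := by positivity
  let b : ContDiffBump (0 : ℝ) := ⟨R * ‖w‖ + 1, R * ‖w‖ + 2, by positivity, by linarith⟩
  let v : SmoothFn ℝ := ⟨fun t => b t * (u : ℝ → ℝ) t, b.contDiff.mul (SmoothFn.contDiff u)⟩
  have huv : T (ridge w u) = T (ridge w v) := by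
    refine hT.congr fun x hx => ?_
    have hx' : inner ℝ x w ∈ Metric.ball (0 : ℝ) (R * ‖w‖ + 1) := by
      rw [mem_ball_zero_iff, Real.norm_eq_abs]
      have h1 := abs_real_inner_le_norm x w
      have h2 := mul_le_mul_of_nonneg_right (mem_ball_zero_iff.1 (hK hx)).le (norm_nonneg w)
      linarith
    have hc : Continuous fun y : E => inner ℝ y w := by fun_prop
    filter_upwards [(Metric.isOpen_ball.preimage hc).mem_nhds hx'] with y hy
    change _ = b _ * _
    rw [b.one_of_mem_closedBall (Metric.ball_subset_closedBall hy), one_mul]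
    rfl
  rw [huv]
  refine apply_eq_zero_of_local (S := T.comp (ridge w).toLinearMap) b.hasCompactSupport.mul_right
    fun p hp => h p ?_ ?_
  all_goals
    rintro rfl
    refine (notMem_tsupport_iff_eventuallyEq.2 ?_) (tsupport_mul_subset_right hp)
    assumption

lemma ridge_smul (w : E) (c : ℝ) (g : SmoothFn ℝ) : ∃ g' : SmoothFn ℝ,
    ridge (c • w) g = ridge w g' ∧ ∀ t, (g' : ℝ → ℝ) t = (g : ℝ → ℝ) (c * t) :=
  ⟨⟨fun t => (g : ℝ → ℝ) (c * t), (SmoothFn.contDiff g).comp (contDiff_const.mul contDiff_id)⟩,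
    Subtype.ext (funext fun x => by rw [ridge_apply, inner_smul_right, ridge_apply]),
    fun _ => rfl⟩

/-- The moments of the projections of a compactly supported distribution are polynomials. -/
lemma exists_moment_polynomial {n : ℕ} (T : SmoothFn (Euc n) →ₗ[ℝ] ℝ) (k : ℕ) :
    ∀ u : SmoothFn (Euc n), ∃ P : MvPolynomial (Fin n) ℝ,
      ∀ w : Euc n, T (u * ridge w (idFn ^ k)) = MvPolynomial.eval w P := by
  induction k with
  | zero => exact fun u => ⟨MvPolynomial.C (T u), fun w => by simp⟩
  | succ k ih =>
    intro u
    let x : Fin n → SmoothFn (Euc n) := fun i =>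
      ⟨fun y => y i, ((EuclideanSpace.proj i : Euc n →L[ℝ] ℝ).contDiff : ContDiff ℝ ∞ _)⟩
    choose P hP using fun i => ih (u * x i)
    refine ⟨∑ i, MvPolynomial.X i * P i, fun w => ?_⟩
    -- One factor `⟨y, w⟩ = ∑ w i * y i` is expanded and its coordinates `y i` join `u`; this is why
    -- the induction runs over all `u`.
    have h1 : u * ridge w (idFn ^ (k + 1)) = ∑ i, w i • (u * x i * ridge w (idFn ^ k)) := by
      refine Subtype.ext (funext fun y => ?_)
      rw [AddSubmonoidClass.coe_finsetSum, Finset.sum_apply]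
      change (u : Euc n → ℝ) y * (inner ℝ y w) ^ (k + 1) =
        ∑ i, w i * ((u : Euc n → ℝ) y * y i * (inner ℝ y w) ^ k)
      have h2 : inner ℝ y w = ∑ i, w i * y i := by
        rw [PiLp.inner_apply]
        rfl
      rw [pow_succ]
      nth_rewrite 2 [h2]
      rw [Finset.mul_sum, Finset.mul_sum]
      exact Finset.sum_congr rfl fun i _ => by ring
    rw [h1, map_sum, map_sum]
    refine Finset.sum_congr rfl fun i _ => ?_
    rw [map_smul, hP, map_mul, MvPolynomial.eval_X, smul_eq_mul]

open FourierTransform in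
/-- A functional of finite order that vanishes at all ridge functions vanishes at all test
functions. -/
lemma HasOrderOn.eq_zero_of_ridge {n : ℕ} {K : Set (Euc n)} {N : ℕ} [CompactSpace K]
    {T : SmoothFn (Euc n) →ₗ[ℝ] ℝ} (hT : HasOrderOn K N T) (h : ∀ w g, T (ridge w g) = 0)
    {u : SmoothFn (Euc n)} (hu : HasCompactSupport (u : Euc n → ℝ)) : T u = 0 := by
  have huc : HasCompactSupport fun x => ((u : Euc n → ℝ) x : ℂ) :=
    hu.comp_left (g := fun t : ℝ => (t : ℂ)) Complex.ofReal_zero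
  let v : SchwartzMap (Euc n) ℂ :=
    huc.toSchwartzMap (Complex.ofRealCLM.contDiff.comp (SmoothFn.contDiff u))
  let V : SchwartzMap (Euc n) ℂ := 𝓕 v
  let cosFn : SmoothFn ℝ := ⟨Real.cos, (Real.contDiff_cos : ContDiff ℝ ∞ _)⟩
  let sinFn : SmoothFn ℝ := ⟨Real.sin, (Real.contDiff_sin : ContDiff ℝ ∞ _)⟩
  have hcos : ∀ i t, ‖iteratedFDeriv ℝ i (cosFn : ℝ → ℝ) t‖ ≤ (fun _ : ℕ => (1 : ℝ)) i :=
    fun i t => by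
      rw [norm_iteratedFDeriv_eq_norm_iteratedDeriv]
      exact Real.abs_iteratedDeriv_cos_le_one i t
  have hsin : ∀ i t, ‖iteratedFDeriv ℝ i (sinFn : ℝ → ℝ) t‖ ≤ (fun _ : ℕ => (1 : ℝ)) i :=
    fun i t => by
      rw [norm_iteratedFDeriv_eq_norm_iteratedDeriv]
      exact Real.abs_iteratedDeriv_sin_le_one i t
  have hι : Continuous fun y : Euc n => (2 * Real.pi) • y := continuous_const_smul _
  have hre : Continuous fun y => (V y).re := Complex.continuous_re.comp V.continuous
  have him : Continuous fun y => (V y).im := Complex.continuous_im.comp V.continuous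
  have hint : ∀ a : Euc n → ℝ, Continuous a → (∀ y, |a y| ≤ ‖V y‖) → ∀ i,
      Integrable (fun y => |a y| * ‖(2 * Real.pi) • y‖ ^ i) := by
    intro a ha hle i
    refine ((V.integrable_pow_mul volume i).const_mul ((2 * Real.pi) ^ i)).mono'
      (ha.abs.mul (hι.norm.pow i)).aestronglyMeasurable (Filter.Eventually.of_forall fun y => ?_)
    rw [norm_smul, mul_pow, Real.norm_of_nonneg (by positivity),
      Real.norm_of_nonneg (by positivity)]
    calc |a y| * ((2 * Real.pi) ^ i * ‖y‖ ^ i) ≤ ‖V y‖ * ((2 * Real.pi) ^ i * ‖y‖ ^ i) :=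
          mul_le_mul_of_nonneg_right (hle y) (by positivity)
      _ = _ := by ring
  have hrei := hint _ hre fun y => Complex.abs_re_le_norm _
  have himi := hint _ him fun y => Complex.abs_im_le_norm _
  -- Real part of the Fourier inversion formula: `u` is a superposition of cosine and sine ridge
  -- functions in the directions `2π y`, with rapidly decreasing weights.
  have hrep : u = ridgeIntegral hι hre hrei hcos - ridgeIntegral hι him himi hsin := by
    refine Subtype.ext (funext fun x => ?_)
    change _ = (∫ y, (V y).re * Real.cos (inner ℝ x ((2 * Real.pi) • y))) -
      ∫ y, (V y).im * Real.sin (inner ℝ x ((2 * Real.pi) • y))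
    have hVi := V.integrable (μ := volume)
    have hcx : Continuous fun y : Euc n => inner ℝ x ((2 * Real.pi) • y) := by fun_prop
    have h1 : Integrable fun y => (V y).re * Real.cos (inner ℝ x ((2 * Real.pi) • y)) :=
      hVi.re.mul_bdd (c := 1) (Real.continuous_cos.comp hcx).aestronglyMeasurable
        (Filter.Eventually.of_forall fun y => Real.abs_cos_le_one _)
    have h2 : Integrable fun y => (V y).im * Real.sin (inner ℝ x ((2 * Real.pi) • y)) :=
      hVi.im.mul_bdd (c := 1) (Real.continuous_sin.comp hcx).aestronglyMeasurable
        (Filter.Eventually.of_forall fun y => Real.abs_sin_le_one _)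
    rw [← integral_sub h1 h2]
    have h3 : ((u : Euc n → ℝ) x : ℂ) =
        ∫ y, Complex.exp (↑(2 * Real.pi * inner ℝ y x) * Complex.I) • V y := by
      have h4 : 𝓕⁻ V = v := FourierTransform.fourierInv_fourier_eq v
      rw [← Real.fourierInv_eq', ← SchwartzMap.fourierInv_coe, h4]
      rfl
    have h5 : Integrable fun y => Complex.exp (↑(2 * Real.pi * inner ℝ y x) * Complex.I) • V y := by
      refine hVi.bdd_smul 1 (Continuous.aestronglyMeasurable ?_)
        (Filter.Eventually.of_forall fun y => (Complex.norm_exp_ofReal_mul_I _).le)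
      fun_prop
    have h6 := congrArg Complex.re h3
    rw [Complex.ofReal_re, ← Complex.reCLM_apply, ← ContinuousLinearMap.integral_comp_comm _ h5]
      at h6
    rw [h6]
    refine integral_congr_ae (Filter.Eventually.of_forall fun y => ?_)
    simp only [Complex.reCLM_apply, smul_eq_mul, Complex.mul_re, Complex.exp_ofReal_mul_I_re,
      Complex.exp_ofReal_mul_I_im, inner_smul_right, real_inner_comm y x]
    ring
  rw [hrep, map_sub, hT.apply_ridgeIntegral, hT.apply_ridgeIntegral]
  simp [h]

end

end RadonSupport

/-! ### Conclusion. -/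

namespace RadonSupport

lemma exists_eq_smul_of_le_one {n : ℕ} (hn : n ≤ 1) :
    ∃ (e : Euc n) (φ : Euc n →ₗ[ℝ] ℝ), ∀ w, w = φ w • e := by
  rcases Nat.le_one_iff_eq_zero_or_eq_one.1 hn with rfl | rfl
  · exact ⟨0, 0, fun w => Subsingleton.elim _ _⟩
  · refine ⟨EuclideanSpace.single 0 1, (EuclideanSpace.proj 0 : Euc 1 →L[ℝ] ℝ).toLinearMap,
      fun w => ?_⟩
    ext i
    fin_cases i
    simp

/-- In dimension at most one, the support function is always that of an ellipsoid. -/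
lemma linear_and_quadratic_of_le_one {n : ℕ} (hn : n ≤ 1) {ρ : Euc n → ℝ}
    (hpos : ∀ c : ℝ, 0 < c → ∀ w, ρ (c • w) = c * ρ w) :
    (∃ ℓ : Euc n →ₗ[ℝ] ℝ, ∀ w, ρ w + -ρ (-w) = ℓ w) ∧
      ∃ b : Euc n →ₗ[ℝ] Euc n →ₗ[ℝ] ℝ, ∀ w, (ρ w - -ρ (-w)) ^ 2 = b w w := by
  obtain ⟨e, φ, he⟩ := exists_eq_smul_of_le_one hn
  have hh : ∀ c : ℝ, 0 ≤ c → ∀ w, ρ (c • w) = c * ρ w := by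
    intro c hc w
    rcases hc.eq_or_lt with rfl | hc
    · have h2 := hpos 2 two_pos 0
      rw [smul_zero] at h2
      rw [zero_smul, zero_mul]
      linarith
    · exact hpos c hc w
  have key : ∀ w, (ρ w = φ w * ρ e ∧ ρ (-w) = φ w * ρ (-e)) ∨
      (ρ w = -φ w * ρ (-e) ∧ ρ (-w) = -φ w * ρ e) := by
    intro w
    rcases le_total 0 (φ w) with h | h
    · left
      constructor
      · rw [← hh _ h, ← he]
      · rw [← hh _ h, smul_neg, ← he]
    · right
      constructor
      · rw [← hh _ (neg_nonneg.2 h), smul_neg, neg_smul, neg_neg, ← he]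
      · rw [← hh _ (neg_nonneg.2 h), neg_smul, ← he]
  refine ⟨⟨(ρ e - ρ (-e)) • φ, fun w => ?_⟩,
    ⟨((ρ e + ρ (-e)) ^ 2) • (LinearMap.mul ℝ ℝ).compl₁₂ φ φ, fun w => ?_⟩⟩
  · rw [LinearMap.smul_apply, smul_eq_mul]
    rcases key w with ⟨h1, h2⟩ | ⟨h1, h2⟩ <;> rw [h1, h2] <;> ring
  · rw [LinearMap.smul_apply, LinearMap.smul_apply, LinearMap.compl₁₂_apply,
      LinearMap.mul_apply', smul_eq_mul]
    rcases key w with ⟨h1, h2⟩ | ⟨h1, h2⟩ <;> rw [h1, h2] <;> ring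

/-- The support function of a domain that carries a distribution whose Radon transform is supported
in the set of supporting planes: its midpoint is linear, and its squared width quadratic. -/
lemma linear_and_quadratic_supportFn {n : ℕ} (hn : 1 < n) {D : Set (Euc n)} (ho : IsOpen D)
    (hb : Bornology.IsBounded D) (hne : D.Nonempty) {f : 𝓓'((⊤ : Opens (Euc n)), ℂ)}
    (hf0 : f ≠ 0) (hfD : dsupport f ⊆ closure D)
    (hR : dsupport (radonTransform f) ⊆ supportingPlanes D) :
    (∃ ℓ : Euc n →ₗ[ℝ] ℝ, ∀ w, supportFn D w + -supportFn D (-w) = ℓ w) ∧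
      ∃ b : Euc n →ₗ[ℝ] Euc n →ₗ[ℝ] ℝ, ∀ w,
        (supportFn D w - -supportFn D (-w)) ^ 2 = b w w := by
  have hfc : IsCompact (dsupport f) := hb.isCompact_closure.of_isClosed_subset
    (isClosed_sInter fun s hs => hs.2) hfD
  obtain ⟨χ, hχ⟩ := exists_cutoff hfc
  obtain ⟨ψ, hψ⟩ : ∃ ψ, f ψ ≠ 0 := by
    by_contra! h
    exact hf0 (ContinuousLinearMap.ext h)
  -- The real or the imaginary part is nonzero; from here on the functional is real.
  obtain ⟨L, hL⟩ : ∃ L : ℂ →L[ℝ] ℝ, L (f ψ) ≠ 0 := by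
    by_contra! h
    exact hψ (Complex.ext (h Complex.reCLM) (h Complex.imCLM))
  have : CompactSpace (tsupport χ) := isCompact_iff_compactSpace.1 χ.hasCompactSupport
  obtain ⟨N, hN⟩ := exists_hasOrderOn (L.comp (f : 𝓓((⊤ : Opens (Euc n)), ℝ) →L[ℝ] ℂ)) χ
  have hT : HasOrderOn (tsupport χ) N (cutDistribution f χ L) := hN
  set T := cutDistribution f χ L with hTdef
  obtain ⟨R, hR0, hKR⟩ := χ.hasCompactSupport.isCompact.isBounded.subset_closedBall_lt 0 (0 : Euc n)
  -- The Radon transform speaks of unit directions; homogeneity of the support function and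
  -- rescaling of the variable transfer the two-point support to every `w ≠ 0`.
  have hproj : ∀ w : Euc n, w ≠ 0 → ∀ u : SmoothFn ℝ,
      (∀ᶠ t in 𝓝 (supportFn D w), (u : ℝ → ℝ) t = 0) →
      (∀ᶠ t in 𝓝 (-supportFn D (-w)), (u : ℝ → ℝ) t = 0) → T (ridge w u) = 0 := by
    intro w hw u h₁ h₂
    have hw0 : 0 < ‖w‖ := norm_pos_iff.2 hw
    let ξ : Sph n := ⟨‖w‖⁻¹ • w, by
      rw [mem_sphere_zero_iff_norm, norm_smul, norm_inv, norm_norm, inv_mul_cancel₀ hw0.ne']⟩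
    have hwξ : w = ‖w‖ • (ξ : Euc n) := by
      change w = ‖w‖ • ‖w‖⁻¹ • w
      rw [smul_smul, mul_inv_cancel₀ hw0.ne', one_smul]
    obtain ⟨u', hu', hu't⟩ := ridge_smul (ξ : Euc n) ‖w‖ u
    have hs₁ : supportFn D w = ‖w‖ * supportFn D ξ := by
      rw [← supportFn_smul hb hne _ hw0, ← hwξ]
    have hs₂ : -supportFn D (-w) = ‖w‖ * -supportFn D (-ξ) := by
      rw [mul_neg, ← supportFn_smul hb hne _ hw0, smul_neg, ← hwξ]
    have hmul : Continuous fun t => ‖w‖ * t := continuous_const.mul continuous_id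
    rw [hwξ, hu']
    refine hT.apply_ridge_eq_zero_of_local (ρ₁ := supportFn D ξ) (ρ₂ := -supportFn D (-ξ))
      (fun p hp₁ hp₂ => ?_) ?_ ?_
    · refine exists_cutDistribution_ridge_eq_zero hfc hχ hT fun hmem => ?_
      rcases eq_of_mem_supportingPlanes hb (hR hmem) with h | h
      · exact hp₁ h
      · exact hp₂ h
    · rw [hs₁] at h₁
      filter_upwards [(hmul.tendsto _).eventually h₁] with t ht
      rw [hu't, ht]
    · rw [hs₂] at h₂
      filter_upwards [(hmul.tendsto _).eventually h₂] with t ht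
      rw [hu't, ht]
  choose M hM using fun k => exists_moment_polynomial T k 1
  let Λ : Euc n → Polynomial ℝ →ₗ[ℝ] ℝ := fun w =>
    (T.comp (ridge w).toLinearMap).comp (Polynomial.aeval idFn).toLinearMap
  have hΛ : ∀ (w : Euc n) k, Λ w (Polynomial.X ^ k) = MvPolynomial.eval w (M k) := by
    intro w k
    rw [← hM, one_mul]
    change T (ridge w (Polynomial.aeval idFn (Polynomial.X ^ k))) = _
    rw [Polynomial.aeval_X_pow]
  have hM0 : ∃ k, M k ≠ 0 := by
    by_contra! hM0
    have hΛ0 : ∀ w, Λ w = 0 := by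
      intro w
      refine Polynomial.lhom_ext' fun k => LinearMap.ext_ring ?_
      change Λ w (Polynomial.monomial k 1) = 0
      rw [← Polynomial.X_pow_eq_monomial, hΛ, hM0, map_zero]
    have hridge : ∀ w g, T (ridge w g) = 0 := fun w g =>
      (hT.isBoundedOn_ridge hKR w).eq_zero_of_polynomial (by positivity)
        (fun P => LinearMap.congr_fun (hΛ0 w) P) g
    have h1 := hT.eq_zero_of_ridge hridge (u := ⟨ψ, ψ.contDiff⟩) ψ.hasCompactSupport
    rw [hTdef, cutDistribution_apply] at h1
    refine hL ?_
    rw [← h1]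
    congr 1
    -- `ψ` and `χ * ψ` agree near the support of `f`, so the cutoff does not change the value at
    -- `ψ`.
    rw [← sub_eq_zero, ← map_sub]
    refine isVanishingOn_compl_dsupport f _ fun x hx hxf => ?_
    refine (notMem_tsupport_iff_eventuallyEq.2 ?_) hx
    filter_upwards [Filter.Eventually.filter_mono (nhds_le_nhdsSet hxf) hχ] with y hy
    change ψ y - χ y * ψ y = 0
    rw [hy, one_mul, sub_self]
  refine linear_and_quadratic_of_moments hn hM0 hΛ (supportFn D) (fun w => -supportFn D (-w))
    (N + 1) ?_ (continuous_supportFn hb hne) ((continuous_supportFn hb hne).comp continuous_neg).neg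
    (fun c hc w => supportFn_smul hb hne c hc w) (fun _ => rfl)
    (fun w hw => neg_supportFn_neg_lt ho hb hne hw)
  intro w hw P
  exact (hT.isBoundedOn_ridge hKR w).apply_polynomial_eq_zero (by positivity)
    (fun u h₁ h₂ => hproj w hw u h₁ h₂) P

end RadonSupport

theorem theorem7p2 (n : ℕ) (D : Set (RadonSupport.Euc n)) (hD_open : IsOpen D)
    (hD_conv : Convex ℝ D) (hD_bdd : Bornology.IsBounded D)
    (hf : ∃ f : 𝓓'((⊤ : Opens (RadonSupport.Euc n)), ℂ), f ≠ 0 ∧ dsupport f ⊆ closure D ∧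
      dsupport (RadonSupport.radonTransform f) ⊆ RadonSupport.supportingPlanes D) :
    RadonSupport.IsEllipsoid (frontier D) := by
  obtain ⟨f, hf0, hfD, hR⟩ := hf
  have hne : D.Nonempty := by
    by_contra hD
    rw [Set.not_nonempty_iff_eq_empty] at hD
    refine hf0 (ContinuousLinearMap.ext fun ψ => ?_)
    refine RadonSupport.isVanishingOn_compl_dsupport f ψ fun x _ hx => ?_
    have := hfD hx
    rw [hD, closure_empty] at this
    exact this
  have h : (∃ ℓ : RadonSupport.Euc n →ₗ[ℝ] ℝ, ∀ w,
      RadonSupport.supportFn D w + -RadonSupport.supportFn D (-w) = ℓ w) ∧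
      ∃ b : RadonSupport.Euc n →ₗ[ℝ] RadonSupport.Euc n →ₗ[ℝ] ℝ, ∀ w,
        (RadonSupport.supportFn D w - -RadonSupport.supportFn D (-w)) ^ 2 = b w w := by
    -- The line without its origin is disconnected, so the argument on multiplicities needs `1 < n`;
    -- in lower dimension homogeneity alone gives both forms.
    rcases le_or_gt n 1 with hn | hn
    · exact RadonSupport.linear_and_quadratic_of_le_one hn fun c hc w =>
        RadonSupport.supportFn_smul hD_bdd hne c hc w
    · exact RadonSupport.linear_and_quadratic_supportFn hn hD_open hD_bdd hne hf0 hfD hR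
  exact RadonSupport.isEllipsoid_frontier hD_open hD_conv hD_bdd hne h.1 h.2
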